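/- Let $\ell>0$, let $\sigma\in L^2(0,\ell)$ be complex-valued, and let $q=\sigma'\in W^{-1,2}(0,\ell)$ (distributional derivative; every element of $W^{-1,2}(0,\ell)$ has this form). For $y\in W^{1,2}(0,\ell)$ let $\mathbf S_q y=-y''+qy\in W^{-1,2}(0,\ell)$ be defined by $$(\mathbf S_q y\,|\,\phi)=\int_0^\ell y'\phi'\,dx-\int_0^\ell \sigma\,(y\phi)'\,dx,\qquad \phi\in W^{1,2}_0(0,\ell).$$ Assume that $f\in W^{1,2}(0,\ell)$ satisfies $\mathbf S_q f=0$, $f(x)\neq 0$ for all $x\in[0,\ell]$, and $f(0)=1$. Put $\mathbf D_f y=y'-\frac{f'}{f}y$, and for $\rho\in\mathbb C$ let $e_f(\rho,\cdot)\in W^{1,2}(0,\ell)$ be the unique solution of $\mathbf S_q y=\rho^2y$ with $\mathbf D_f y\in W^{1,2}(0,\ell)$, $y(0)=1$ and $(\mathbf D_f y)(0)=i\rho$ (Sobolev functions being identified with their continuous representatives). Then there is a kernel $K_f$ that is square integrable on the triangle $\{(x,t): 0\le x\le \ell,\ |t|\le x\}$, with $K_f(x,\cdot)\in L^2(-x,x)$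 for every $x\in(0,\ell]$, such that $$e_f(\rho,x)=e^{i\rho x}+\int_{-x}^{x}K_f(x,t)e^{i\rho t}\,dt\qquad (\rho\in\mathbb C,\ 0<x\le \ell).$$ Moreover, for every such kernel, the operator $$\mathbf T_f u(x)=u(x)+\int_{-x}^{x}K_f(x,t)u(t)\,dt,\qquad 0\le x\le \ell,$$ maps $C[-\ell,\ell]$ into $C[0,\ell]$, and $\mathbf T_f$ is a bounded linear operator from $C[-\ell,\ell]$ to $C[0,\ell]$ (complex-valued functions, supremum norms). -/

import Mathlib

open MeasureTheory Set

namespace DistSchrodinger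

/-- `u ∈ W^{1,2}(0,ℓ)` with derivative `u' ∈ L²(0,ℓ)`. As usual in one dimension, `u` stands for
the absolutely continuous representative on `[0,ℓ]`, so that `u` is the primitive of `u'`. -/
structure HasL2Deriv (ℓ : ℝ) (u u' : ℝ → ℂ) : Prop where
  memLp : MemLp u' 2 (volume.restrict (Ioo 0 ℓ))
  eq_integral : ∀ x ∈ Icc 0 ℓ, u x = u 0 + ∫ t in (0 : ℝ)..x, u' t

/-- `y ∈ W^{1,2}(0,ℓ)` solves `-y'' + q y = lam y` on `(0,ℓ)`, where `q = σ' ∈ W^{-1,2}(0,ℓ)` is the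
distributional derivative of `σ ∈ L²(0,ℓ)`. Both sides are functionals on `W_0^{1,2}(0,ℓ)`:
`⟨S_q y, φ⟩ = ∫ y' φ' + ⟨q, y φ⟩ = ∫ y' φ' - ∫ σ (y φ)'`. -/
def SolvesSchrodinger (ℓ : ℝ) (σ : ℝ → ℂ) (lam : ℂ) (y : ℝ → ℂ) : Prop :=
  ∃ y' : ℝ → ℂ, HasL2Deriv ℓ y y' ∧
    ∀ φ φ' : ℝ → ℂ, HasL2Deriv ℓ φ φ' → φ 0 = 0 → φ ℓ = 0 →
      (∫ x in (0 : ℝ)..ℓ, y' x * φ' x) - (∫ x in (0 : ℝ)..ℓ, σ x * (y' x * φ x + y x * φ' x))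
        = lam * ∫ x in (0 : ℝ)..ℓ, y x * φ x

/-- `v` is the continuous representative of `D_f y = y' - (f'/f) y`, and `v ∈ W^{1,2}(0,ℓ)`. -/
def IsQuasiDeriv (ℓ : ℝ) (f y v : ℝ → ℂ) : Prop :=
  (∃ f' y' : ℝ → ℂ, HasL2Deriv ℓ f f' ∧ HasL2Deriv ℓ y y' ∧
    ∀ᵐ x ∂(volume.restrict (Ioo 0 ℓ)), v x = y' x - f' x / f x * y x) ∧
  ∃ v' : ℝ → ℂ, HasL2Deriv ℓ v v'

/-- `f` is a nonvanishing solution of `S_q f = 0`, `q = σ'`, normalized by `f(0) = 1`. -/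
structure IsNonvanishingSolution (ℓ : ℝ) (σ f : ℝ → ℂ) : Prop where
  solves : SolvesSchrodinger ℓ σ 0 f
  ne_zero : ∀ x ∈ Icc 0 ℓ, f x ≠ 0
  normalized : f 0 = 1

/-- `y = e_f(ρ, ·)`: the solution of `S_q y = ρ² y` with `y(0) = 1` and `(D_f y)(0) = iρ`. -/
structure IsExpSolution (ℓ : ℝ) (σ f : ℝ → ℂ) (ρ : ℂ) (y : ℝ → ℂ) : Prop where
  solves : SolvesSchrodinger ℓ σ (ρ ^ 2) y
  init : y 0 = 1
  init_quasi : ∃ v : ℝ → ℂ, IsQuasiDeriv ℓ f y v ∧ v 0 = Complex.I * ρ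

/-- The operator `u ↦ u(x) + ∫_{-x}^{x} K(x,t) u(t) dt`. -/
noncomputable def transmutation (K : ℝ → ℝ → ℂ) (u : ℝ → ℂ) (x : ℝ) : ℂ :=
  u x + ∫ t in (-x)..x, K x t * u t

/-- The triangle `0 ≤ x ≤ ℓ`, `|t| ≤ x`. -/
def triangle (ℓ : ℝ) : Set (ℝ × ℝ) := {p | 0 ≤ p.1 ∧ p.1 ≤ ℓ ∧ |p.2| ≤ p.1}

/-- `K` is the transmutation kernel `K_f`: it is square integrable on the triangle and on each
slice, and `e_f(ρ,x) = e^{iρx} + ∫_{-x}^{x} K(x,t) e^{iρt} dt` for all `ρ ∈ ℂ`, `0 < x ≤ ℓ`. -/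
structure IsTransmutationKernel (ℓ : ℝ) (σ f : ℝ → ℂ) (K : ℝ → ℝ → ℂ) : Prop where
  memLp : MemLp (fun p : ℝ × ℝ => K p.1 p.2) 2 (volume.restrict (triangle ℓ))
  memLp_slice : ∀ x ∈ Ioc 0 ℓ, MemLp (K x) 2 (volume.restrict (Ioo (-x) x))
  repr : ∀ ρ : ℂ, ∃ e : ℝ → ℂ, IsExpSolution ℓ σ f ρ e ∧
    ∀ x ∈ Ioc 0 ℓ, e x = transmutation K (fun t => Complex.exp (Complex.I * ρ * t)) x

end DistSchrodinger

/-! The solution `f` factors the operator as -(∂ + h)(∂ - h) with h = f'/f in L², which removes σ.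
With v = y' - h y, the equation for y becomes the first-order system y' = h y + v, v' = -h v - ρ² y,
in which only the L² function h appears (`solvesSchrodinger_of_system`,
`ae_eq_of_solvesSchrodinger`). A Gronwall argument gives uniqueness (`IsExpSolution.eqOn`).

Existence of the kernel: the system decouples into functions J_ρ with J_ρ' = -iρ J_ρ + h J_{-ρ},
J_ρ(0) = 1, one family for h and one for -h; `expSolution` is a combination of four of them. Writing
J_ρ(x) = e^{-iρx}(1 + ∫ S(x,t) e^{iρt} dt) turns this into the ρ-free Volterra equation S(x,t) =
h(t/2)/2 + ∫_0^x h(s) S(s, 2s-t) ds on 0 ≤ t ≤ 2x. The source is only L², but its first iterate is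
bounded and later iterates decay geometrically, so S is an L² source plus a bounded remainder
(`volterraOp_volterraKernel`, `kernelTransform_eq`). Recentring t to [-x,x] yields `expKernel`,
whose slices are bounded in L¹ and L² uniformly in x.

The operator: at fixed x, any admissible kernel and `expKernel` define continuous functionals on
C[-ℓ,ℓ] that agree on exponentials by uniqueness, hence everywhere by Stone–Weierstrass
(`transmutation_eq_of_exp`). For `expKernel`, images of exponentials are the continuous functions
`expSolution`, and the uniform L¹ bound extends continuity and boundedness to all of C[-ℓ,ℓ]. -/

namespace DistSchrodinger

open Filter Topology

/-! ### Absolute continuity of complex-valued functions. -/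

section AbsolutelyContinuous

variable {X Y : Type*} [PseudoMetricSpace X] [PseudoMetricSpace Y] {f : ℝ → X} {g : ℝ → Y} {a b : ℝ}

/-- Domination of increments: used below for complex primitives and for reciprocals. -/
lemma absolutelyContinuousOnInterval_of_dist_le (hf : AbsolutelyContinuousOnInterval f a b)
    (C : ℝ) (h : ∀ x ∈ uIcc a b, ∀ y ∈ uIcc a b, dist (g x) (g y) ≤ C * dist (f x) (f y)) :
    AbsolutelyContinuousOnInterval g a b := by
  have hf' := Filter.Tendsto.const_mul C hf
  rw [mul_zero] at hf'
  refine squeeze_zero' (Eventually.of_forall fun _ => Finset.sum_nonneg fun _ _ => dist_nonneg) ?_ hf'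
  rw [eventually_inf_principal]
  refine Eventually.of_forall fun E hE => ?_
  rw [Finset.mul_sum]
  exact Finset.sum_le_sum fun i hi => h _ (hE.1 i hi).1 _ (hE.1 i hi).2

end AbsolutelyContinuous

/-- Increments are dominated by those of the primitive of ‖g‖, which is real-valued. -/
lemma absolutelyContinuousOnInterval_primitive {g : ℝ → ℂ} {a b : ℝ}
    (hg : IntervalIntegrable g volume a b) :
    AbsolutelyContinuousOnInterval (fun x => ∫ t in a..x, g t) a b := by
  refine absolutelyContinuousOnInterval_of_dist_le
    (hg.norm.absolutelyContinuousOnInterval_intervalIntegral left_mem_uIcc) 1 fun x hx y hy => ?_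
  have hax : ∀ z ∈ uIcc a b, IntervalIntegrable g volume a z := fun z hz =>
    hg.mono_set (uIcc_subset_uIcc left_mem_uIcc hz)
  rw [one_mul, dist_eq_norm, dist_eq_norm,
    intervalIntegral.integral_interval_sub_left (hax x hx) (hax y hy),
    intervalIntegral.integral_interval_sub_left (hax x hx).norm (hax y hy).norm, Real.norm_eq_abs]
  exact intervalIntegral.norm_integral_le_abs_integral_norm

/-! ### Calculus in W^{1,2}(0,ℓ). -/

section Sobolev

variable {ℓ : ℝ} {u u' w w' : ℝ → ℂ}

lemma intervalIntegrable_of_memLp {E : Type*} [NormedAddCommGroup E] {u : ℝ → E} (hℓ : 0 < ℓ)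
    {p : ENNReal} (hp : 1 ≤ p)
    (h : MemLp u p (volume.restrict (Ioo 0 ℓ))) : IntervalIntegrable u volume 0 ℓ := by
  rw [intervalIntegrable_iff_integrableOn_Ioo_of_le hℓ.le]
  exact h.integrable hp

lemma HasL2Deriv.intervalIntegrable (hℓ : 0 < ℓ) (h : HasL2Deriv ℓ u u') :
    IntervalIntegrable u' volume 0 ℓ :=
  intervalIntegrable_of_memLp hℓ (by norm_num) h.memLp

lemma HasL2Deriv.absolutelyContinuous (hℓ : 0 < ℓ) (h : HasL2Deriv ℓ u u') :
    AbsolutelyContinuousOnInterval u 0 ℓ := by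
  refine absolutelyContinuousOnInterval_of_dist_le
    (absolutelyContinuousOnInterval_primitive (h.intervalIntegrable hℓ)) 1 fun x hx y hy => ?_
  rw [uIcc_of_le hℓ.le] at hx hy
  rw [h.eq_integral x hx, h.eq_integral y hy, one_mul, dist_add_left]

lemma HasL2Deriv.continuousOn (hℓ : 0 < ℓ) (h : HasL2Deriv ℓ u u') : ContinuousOn u (Icc 0 ℓ) := by
  simpa [uIcc_of_le hℓ.le] using (h.absolutelyContinuous hℓ).continuousOn

lemma HasL2Deriv.ae_hasDerivAt (hℓ : 0 < ℓ) (h : HasL2Deriv ℓ u u') :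
    ∀ᵐ x, x ∈ Ioo 0 ℓ → HasDerivAt u (u' x) x := by
  filter_upwards [(h.intervalIntegrable hℓ).ae_hasDerivAt_integral] with x hx hxI
  rw [uIcc_of_le hℓ.le] at hx
  refine ((hx ⟨hxI.1.le, hxI.2.le⟩ 0 ⟨le_rfl, hℓ.le⟩).const_add (u 0)).congr_of_eventuallyEq ?_
  filter_upwards [isOpen_Ioo.mem_nhds hxI] with y hy
  exact h.eq_integral y ⟨hy.1.le, hy.2.le⟩

/-- The difference between `u` and the primitive of `u'` is absolutely continuous with derivative
zero almost everywhere, hence constant. This reduces sums, products and inverses to pointwise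
differentiation rules. -/
lemma hasL2Deriv_of_absolutelyContinuous (hℓ : 0 < ℓ)
    (hm : MemLp u' 2 (volume.restrict (Ioo 0 ℓ))) (hu : AbsolutelyContinuousOnInterval u 0 ℓ)
    (hd : ∀ᵐ x, x ∈ Ioo 0 ℓ → HasDerivAt u (u' x) x) : HasL2Deriv ℓ u u' := by
  have hi := intervalIntegrable_of_memLp hℓ (by norm_num) hm
  refine ⟨hm, fun x hx => ?_⟩
  have hac := AbsolutelyContinuousOnInterval.fun_sub hu
    (absolutelyContinuousOnInterval_primitive hi)
  have h0 : ∀ᵐ x, x ∈ uIcc 0 ℓ → HasDerivAt (fun y => u y - ∫ t in (0 : ℝ)..y, u' t) 0 x := by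
    have e0 : ∀ᵐ x : ℝ, x ≠ 0 := by simp [ae_iff, measure_singleton]
    have e1 : ∀ᵐ x : ℝ, x ≠ ℓ := by simp [ae_iff, measure_singleton]
    filter_upwards [hd, hi.ae_hasDerivAt_integral, e0, e1] with x h1 h2 h3 h4 hx
    have h5 := h2 hx 0 left_mem_uIcc
    rw [uIcc_of_le hℓ.le] at hx
    have := (h1 ⟨lt_of_le_of_ne hx.1 (Ne.symm h3), lt_of_le_of_ne hx.2 h4⟩).sub h5
    rwa [sub_self] at this
  obtain ⟨C, hC⟩ := hac.const_of_ae_hasDerivAt_zero h0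
  have h1 := hC 0 left_mem_uIcc
  have h2 := hC x (by rwa [uIcc_of_le hℓ.le])
  simp only [intervalIntegral.integral_same, sub_zero] at h1
  rw [h1, ← h2]; ring

lemma memLp_continuousOn_mul (hu : ContinuousOn u (Icc 0 ℓ))
    (hw : MemLp w 2 (volume.restrict (Ioo 0 ℓ))) :
    MemLp (fun x => u x * w x) 2 (volume.restrict (Ioo 0 ℓ)) := by
  obtain ⟨C, hC⟩ := isCompact_Icc.exists_bound_of_continuousOn hu
  refine MemLp.of_le_mul (c := C) hw
    (((hu.mono Ioo_subset_Icc_self).aestronglyMeasurable measurableSet_Ioo).mul hw.1) ?_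
  filter_upwards [ae_restrict_mem measurableSet_Ioo] with x hx
  rw [norm_mul]
  gcongr
  exact hC x (Ioo_subset_Icc_self hx)

lemma memLp_of_continuousOn (hu : ContinuousOn u (Icc 0 ℓ)) (p : ENNReal) :
    MemLp u p (volume.restrict (Ioo 0 ℓ)) := by
  obtain ⟨C, hC⟩ := isCompact_Icc.exists_bound_of_continuousOn hu
  refine MemLp.of_bound ((hu.mono Ioo_subset_Icc_self).aestronglyMeasurable measurableSet_Ioo) C ?_
  filter_upwards [ae_restrict_mem measurableSet_Ioo] with x hx
  exact hC x (Ioo_subset_Icc_self hx)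

lemma HasL2Deriv.add (hℓ : 0 < ℓ) (hu : HasL2Deriv ℓ u u') (hw : HasL2Deriv ℓ w w') :
    HasL2Deriv ℓ (fun x => u x + w x) (fun x => u' x + w' x) := by
  refine hasL2Deriv_of_absolutelyContinuous hℓ (hu.memLp.add hw.memLp)
    (AbsolutelyContinuousOnInterval.fun_add (hu.absolutelyContinuous hℓ)
      (hw.absolutelyContinuous hℓ)) ?_
  filter_upwards [hu.ae_hasDerivAt hℓ, hw.ae_hasDerivAt hℓ] with x h1 h2 hx
  exact (h1 hx).add (h2 hx)

lemma HasL2Deriv.const_mul (hℓ : 0 < ℓ) (c : ℂ) (hu : HasL2Deriv ℓ u u') :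
    HasL2Deriv ℓ (fun x => c * u x) (fun x => c * u' x) := by
  refine hasL2Deriv_of_absolutelyContinuous hℓ (hu.memLp.const_mul c)
    (AbsolutelyContinuousOnInterval.const_smul c (hu.absolutelyContinuous hℓ)) ?_
  filter_upwards [hu.ae_hasDerivAt hℓ] with x h1 hx
  exact (h1 hx).const_mul c

lemma HasL2Deriv.sub (hℓ : 0 < ℓ) (hu : HasL2Deriv ℓ u u') (hw : HasL2Deriv ℓ w w') :
    HasL2Deriv ℓ (fun x => u x - w x) (fun x => u' x - w' x) := by
  simpa [sub_eq_add_neg] using hu.add hℓ (hw.const_mul hℓ (-1))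

lemma HasL2Deriv.mul (hℓ : 0 < ℓ) (hu : HasL2Deriv ℓ u u') (hw : HasL2Deriv ℓ w w') :
    HasL2Deriv ℓ (fun x => u x * w x) (fun x => u' x * w x + u x * w' x) := by
  have hac := AbsolutelyContinuousOnInterval.fun_smul (hu.absolutelyContinuous hℓ)
    (hw.absolutelyContinuous hℓ)
  simp only [smul_eq_mul] at hac
  refine hasL2Deriv_of_absolutelyContinuous hℓ ?_ hac ?_
  · have h1 := memLp_continuousOn_mul (hw.continuousOn hℓ) hu.memLp
    have h2 := memLp_continuousOn_mul (hu.continuousOn hℓ) hw.memLp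
    simp only [mul_comm (w _)] at h1
    exact h1.add h2
  · filter_upwards [hu.ae_hasDerivAt hℓ, hw.ae_hasDerivAt hℓ] with x h1 h2 hx
    exact (h1 hx).mul (h2 hx)

lemma HasL2Deriv.inv (hℓ : 0 < ℓ) (hu : HasL2Deriv ℓ u u') (h0 : ∀ x ∈ Icc 0 ℓ, u x ≠ 0) :
    HasL2Deriv ℓ (fun x => (u x)⁻¹) (fun x => -u' x / u x ^ 2) := by
  have hc : ContinuousOn (fun x => (u x)⁻¹) (Icc 0 ℓ) := (hu.continuousOn hℓ).inv₀ h0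
  obtain ⟨C, hC⟩ := isCompact_Icc.exists_bound_of_continuousOn hc
  have hC0 : 0 ≤ C := (norm_nonneg _).trans (hC 0 ⟨le_rfl, hℓ.le⟩)
  refine hasL2Deriv_of_absolutelyContinuous hℓ ?_
    (absolutelyContinuousOnInterval_of_dist_le (hu.absolutelyContinuous hℓ) (C * C)
      fun x hx y hy => ?_) ?_
  · convert (memLp_continuousOn_mul (hc.mul hc) hu.memLp).const_mul (-1) using 2 with x
    simp only [div_eq_mul_inv, sq, mul_inv, Pi.mul_apply]
    ring
  · rw [uIcc_of_le hℓ.le] at hx hy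
    have hx0 := h0 x hx
    have hy0 := h0 y hy
    have : (u x)⁻¹ - (u y)⁻¹ = -((u x)⁻¹ * (u y)⁻¹ * (u x - u y)) := by
      field_simp; ring
    rw [dist_eq_norm, dist_eq_norm, this, norm_neg, norm_mul, norm_mul]
    gcongr
    · exact hC x hx
    · exact hC y hy
  · filter_upwards [hu.ae_hasDerivAt hℓ] with x h1 hx
    exact (h1 hx).inv (h0 x (Ioo_subset_Icc_self hx))

lemma HasL2Deriv.ae_unique (hℓ : 0 < ℓ) (hu : HasL2Deriv ℓ u u') (hw : HasL2Deriv ℓ u w') :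
    ∀ᵐ x ∂(volume.restrict (Ioo 0 ℓ)), u' x = w' x := by
  rw [ae_restrict_iff' measurableSet_Ioo]
  filter_upwards [hu.ae_hasDerivAt hℓ, hw.ae_hasDerivAt hℓ] with x h1 h2 hx
  exact (h1 hx).unique (h2 hx)

lemma intervalIntegral_congr_ae_Ioo (h : ∀ᵐ x ∂(volume.restrict (Ioo 0 ℓ)), u x = w x) {x : ℝ}
    (hx : x ∈ Icc 0 ℓ) : ∫ t in (0 : ℝ)..x, u t = ∫ t in (0 : ℝ)..x, w t := by
  refine intervalIntegral.integral_congr_ae ?_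
  rw [ae_restrict_iff' measurableSet_Ioo] at h
  have e1 : ∀ᵐ x : ℝ, x ≠ ℓ := by simp [ae_iff, measure_singleton]
  filter_upwards [h, e1] with t ht h1 hxt
  rw [uIoc_of_le hx.1] at hxt
  exact ht ⟨hxt.1, lt_of_le_of_ne (hxt.2.trans hx.2) h1⟩

lemma HasL2Deriv.congr_deriv (hu : HasL2Deriv ℓ u u')
    (h : ∀ᵐ x ∂(volume.restrict (Ioo 0 ℓ)), u' x = w' x) : HasL2Deriv ℓ u w' := by
  refine ⟨hu.memLp.ae_eq h, fun x hx => ?_⟩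
  rw [hu.eq_integral x hx, intervalIntegral_congr_ae_Ioo h hx]

lemma hasL2Deriv_of_contDiff (hu : ContDiff ℝ 1 u) : HasL2Deriv ℓ u (deriv u) := by
  refine ⟨memLp_of_continuousOn (hu.continuous_deriv le_rfl).continuousOn 2, fun x _ => ?_⟩
  rw [intervalIntegral.integral_deriv_eq_sub
    (fun x _ => (hu.differentiable one_ne_zero).differentiableAt)
    ((hu.continuous_deriv le_rfl).intervalIntegrable _ _)]
  ring

end Sobolev

/-! ### Exponentially weighted Gronwall estimates. -/

/-- In the sup norm weighted by e^{-λx}, integration against ‖k‖ is a contraction with factor 1/2.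
It is the source of both uniqueness and the convergence of the Volterra series. -/
lemma exists_weight {E : Type*} [NormedAddCommGroup E] {ℓ : ℝ} (hℓ : 0 < ℓ) {k : ℝ → E}
    (hk : MemLp k 2 (volume.restrict (Ioo 0 ℓ))) :
    ∃ lam : ℝ, 0 < lam ∧ ∀ x ∈ Icc 0 ℓ,
      ∫ s in (0 : ℝ)..x, ‖k s‖ * Real.exp (lam * s) ≤ 1 / 2 * Real.exp (lam * x) := by
  have hk2 : IntervalIntegrable (fun s => ‖k s‖ ^ 2) volume 0 ℓ := by
    rw [intervalIntegrable_iff_integrableOn_Ioo_of_le hℓ.le]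
    exact hk.norm.integrable_sq
  have hk1 : IntervalIntegrable (fun s => ‖k s‖) volume 0 ℓ := by
    rw [intervalIntegrable_iff_integrableOn_Ioo_of_le hℓ.le]
    exact hk.norm.integrable (by norm_num)
  set I := ∫ s in (0 : ℝ)..ℓ, ‖k s‖ ^ 2
  have hI : 0 ≤ I := intervalIntegral.integral_nonneg hℓ.le fun s _ => sq_nonneg _
  -- With this λ, I/(2λ) ≤ 1/4. The bound ‖k‖E ≤ ‖k‖²/(2λ) + (λ/2)E² for E = e^{λ(s-x)} then
  -- integrates to at most 1/4 + 1/4.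
  refine ⟨2 * (I + 1), by positivity, fun x hx => ?_⟩
  set lam := 2 * (I + 1)
  have hlam : 0 < lam := by positivity
  have hsub : uIcc 0 x ⊆ uIcc 0 ℓ := by
    rw [uIcc_of_le hℓ.le, uIcc_of_le hx.1]; exact Icc_subset_Icc_right hx.2
  have hk2x := hk2.mono_set hsub
  have hk1x := hk1.mono_set hsub
  have hIx : ∫ s in (0 : ℝ)..x, ‖k s‖ ^ 2 ≤ I :=
    intervalIntegral.integral_mono_interval le_rfl hx.1 hx.2
      (Eventually.of_forall fun s => sq_nonneg _) hk2
  have hexp : ∫ s in (0 : ℝ)..x, Real.exp (2 * lam * (s - x)) ≤ 1 / (2 * lam) := by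
    have hd : ∀ s ∈ uIcc 0 x, HasDerivAt (fun s => Real.exp (2 * lam * (s - x)) / (2 * lam))
        (Real.exp (2 * lam * (s - x))) s := by
      intro s _
      have := (((((hasDerivAt_id s).sub_const x).const_mul (2 * lam)).exp).div_const (2 * lam))
      refine this.congr_deriv ?_
      simp only [id]
      field_simp
    rw [intervalIntegral.integral_eq_sub_of_hasDerivAt hd
      (Continuous.intervalIntegrable (by fun_prop) _ _)]
    simp only [sub_self, mul_zero, Real.exp_zero]
    have : 0 ≤ Real.exp (2 * lam * (0 - x)) / (2 * lam) := by positivity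
    linarith
  have hpt : ∀ s, ‖k s‖ * Real.exp (lam * (s - x)) ≤
      1 / (2 * lam) * ‖k s‖ ^ 2 + lam / 2 * Real.exp (2 * lam * (s - x)) := by
    intro s
    have h1 : Real.exp (2 * lam * (s - x)) = Real.exp (lam * (s - x)) ^ 2 := by
      rw [← Real.exp_nat_mul]; congr 1; push_cast; ring
    rw [h1]
    have := sq_nonneg (‖k s‖ - lam * Real.exp (lam * (s - x)))
    have h2 : 1 / (2 * lam) * ‖k s‖ ^ 2 + lam / 2 * Real.exp (lam * (s - x)) ^ 2
      - ‖k s‖ * Real.exp (lam * (s - x)) =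
        1 / (2 * lam) * (‖k s‖ - lam * Real.exp (lam * (s - x))) ^ 2 := by
      field_simp; ring
    have h3 : 0 ≤ 1 / (2 * lam) * (‖k s‖ - lam * Real.exp (lam * (s - x))) ^ 2 := by positivity
    linarith
  have hmain : ∫ s in (0 : ℝ)..x, ‖k s‖ * Real.exp (lam * (s - x)) ≤ 1 / 2 := by
    have hle := intervalIntegral.integral_mono_on hx.1
      (hk1x.mul_continuousOn (g := fun s => Real.exp (lam * (s - x))) (by fun_prop))
      ((hk2x.const_mul (1 / (2 * lam))).add
        ((Continuous.intervalIntegrable (by fun_prop : Continuous fun s =>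
          Real.exp (2 * lam * (s - x))) 0 x).const_mul (lam / 2)))
      (fun s _ => hpt s)
    rw [intervalIntegral.integral_add (hk2x.const_mul _)
      ((Continuous.intervalIntegrable (by fun_prop) 0 x).const_mul _),
      intervalIntegral.integral_const_mul, intervalIntegral.integral_const_mul] at hle
    have h1 : 1 / (2 * lam) * ∫ s in (0 : ℝ)..x, ‖k s‖ ^ 2 ≤ 1 / (2 * lam) * I := by gcongr
    have h2 : lam / 2 * ∫ s in (0 : ℝ)..x, Real.exp (2 * lam * (s - x)) ≤
      lam / 2 * (1 / (2 * lam)) := by gcongr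
    have h3 : lam / 2 * (1 / (2 * lam)) = 1 / 4 := by field_simp; norm_num
    have h4 : 1 / (2 * lam) * I ≤ 1 / 4 := by
      rw [one_div, inv_mul_le_iff₀ (by positivity)]
      simp only [lam]; linarith
    linarith
  have : ∫ s in (0 : ℝ)..x, ‖k s‖ * Real.exp (lam * s) =
      (∫ s in (0 : ℝ)..x, ‖k s‖ * Real.exp (lam * (s - x))) * Real.exp (lam * x) := by
    rw [← intervalIntegral.integral_mul_const]
    congr 1; ext s
    rw [mul_assoc ‖k s‖, ← Real.exp_add]; congr 2; ring
  rw [this]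
  gcongr

/-- The maximum M of N(x)e^{-λx} satisfies M ≤ M/2, so it vanishes. -/
lemma eq_zero_of_le_integral_mul {E : Type*} [NormedAddCommGroup E] {ℓ : ℝ} (hℓ : 0 < ℓ)
    {k : ℝ → E} (hk : MemLp k 2 (volume.restrict (Ioo 0 ℓ))) {N : ℝ → ℝ}
    (hc : ContinuousOn N (Icc 0 ℓ)) (h0 : ∀ x ∈ Icc 0 ℓ, 0 ≤ N x)
    (hN : ∀ x ∈ Icc 0 ℓ, N x ≤ ∫ s in (0 : ℝ)..x, ‖k s‖ * N s) : ∀ x ∈ Icc 0 ℓ, N x = 0 := by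
  obtain ⟨lam, -, hw⟩ := exists_weight hℓ hk
  obtain ⟨x₀, hx₀, hmax⟩ := isCompact_Icc.exists_isMaxOn (nonempty_Icc.2 hℓ.le)
    (f := fun x => N x * Real.exp (-(lam * x))) (hc.mul (by fun_prop))
  set M := N x₀ * Real.exp (-(lam * x₀)) with hM
  have hle : ∀ x ∈ Icc 0 ℓ, N x ≤ M * Real.exp (lam * x) := fun x hx => by
    have : N x * Real.exp (-(lam * x)) ≤ M := hmax hx
    rwa [Real.exp_neg, ← div_eq_mul_inv, div_le_iff₀ (Real.exp_pos _)] at this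
  have hk1 : IntervalIntegrable (fun s => ‖k s‖) volume 0 ℓ := by
    rw [intervalIntegrable_iff_integrableOn_Ioo_of_le hℓ.le]
    exact hk.norm.integrable (by norm_num)
  have hsub : uIcc 0 x₀ ⊆ uIcc 0 ℓ := by
    rw [uIcc_of_le hℓ.le, uIcc_of_le hx₀.1]; exact Icc_subset_Icc_right hx₀.2
  have hsub' : uIcc 0 x₀ ⊆ Icc 0 ℓ := by rwa [← uIcc_of_le hℓ.le]
  have hM0 : 0 ≤ M := mul_nonneg (h0 x₀ hx₀) (Real.exp_pos _).le
  have key : N x₀ ≤ M * (1 / 2 * Real.exp (lam * x₀)) := by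
    refine (hN x₀ hx₀).trans ?_
    calc ∫ s in (0 : ℝ)..x₀, ‖k s‖ * N s
        ≤ ∫ s in (0 : ℝ)..x₀, M * (‖k s‖ * Real.exp (lam * s)) := by
          refine intervalIntegral.integral_mono_on hx₀.1
            ((hk1.mono_set hsub).mul_continuousOn (hc.mono hsub'))
            (((hk1.mono_set hsub).mul_continuousOn (by fun_prop)).const_mul M) fun s hs => ?_
          rw [mul_left_comm]
          gcongr
          exact hle s ⟨hs.1, hs.2.trans hx₀.2⟩
      _ ≤ _ := by
          rw [intervalIntegral.integral_const_mul]
          gcongr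
          exact hw x₀ hx₀
  have hM1 : M ≤ M * (1 / 2) := by
    conv_lhs => rw [hM]
    rw [Real.exp_neg, ← div_eq_mul_inv, div_le_iff₀ (Real.exp_pos _), mul_assoc]
    exact key
  have hM2 : M = 0 := by linarith
  intro x hx
  have := hle x hx
  rw [hM2, zero_mul] at this
  exact le_antisymm this (h0 x hx)

/-! ### Factorization, the first-order system, and uniqueness. -/

section Factorization

variable {ℓ : ℝ} {σ f f' y y' v v' φ φ' : ℝ → ℂ} {lam : ℂ}

lemma intervalIntegrable_mul_of_memLp {g h : ℝ → ℂ} (hℓ : 0 < ℓ)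
    (hg : MemLp g 2 (volume.restrict (Ioo 0 ℓ))) (hh : MemLp h 2 (volume.restrict (Ioo 0 ℓ))) :
    IntervalIntegrable (fun x => g x * h x) volume 0 ℓ := by
  rw [intervalIntegrable_iff_integrableOn_Ioo_of_le hℓ.le]
  exact hg.integrable_mul hh

/-- The weak form of the factorization `-y'' + q y = -(∂ + f'/f)(∂ - f'/f) y`. -/
lemma weakForm_eq_integral (hℓ : 0 < ℓ) (hf : HasL2Deriv ℓ f f') (hf0 : ∀ x ∈ Icc 0 ℓ, f x ≠ 0)
    (hfs : ∀ φ φ' : ℝ → ℂ, HasL2Deriv ℓ φ φ' → φ 0 = 0 → φ ℓ = 0 →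
      (∫ x in (0 : ℝ)..ℓ, f' x * φ' x) - (∫ x in (0 : ℝ)..ℓ, σ x * (f' x * φ x + f x * φ' x)) = 0)
    (hy : HasL2Deriv ℓ y y')
    (hv : ∀ᵐ x ∂(volume.restrict (Ioo 0 ℓ)), v x = y' x - f' x / f x * y x)
    (hφ : HasL2Deriv ℓ φ φ') (hφ0 : φ 0 = 0) (hφℓ : φ ℓ = 0) :
    (∫ x in (0 : ℝ)..ℓ, y' x * φ' x) - (∫ x in (0 : ℝ)..ℓ, σ x * (y' x * φ x + y x * φ' x))
      = ∫ x in (0 : ℝ)..ℓ, v x * φ' x - f' x / f x * v x * φ x := by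
  -- Testing the equation of `f` with ψ = yφ/f gives fψ = yφ, so the σ-terms of both weak forms
  -- coincide and cancel.
  have hψ := (hy.mul hℓ hφ).mul hℓ (hf.inv hℓ hf0)
  have h1 := hfs _ _ hψ (by simp [hφ0]) (by simp [hφℓ])
  have h2 : ∫ x in (0 : ℝ)..ℓ, σ x * (f' x * (y x * φ x * (f x)⁻¹) + f x *
      ((y' x * φ x + y x * φ' x) * (f x)⁻¹ + y x * φ x * (-f' x / f x ^ 2))) =
      ∫ x in (0 : ℝ)..ℓ, σ x * (y' x * φ x + y x * φ' x) := by
    refine intervalIntegral.integral_congr fun x hx => ?_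
    rw [uIcc_of_le hℓ.le] at hx
    have := hf0 x hx
    congr 1
    field_simp
    ring
  rw [h2, sub_eq_zero] at h1
  rw [← h1, ← intervalIntegral.integral_sub (intervalIntegrable_mul_of_memLp hℓ hy.memLp hφ.memLp)
    (intervalIntegrable_mul_of_memLp hℓ hf.memLp hψ.memLp)]
  refine intervalIntegral_congr_ae_Ioo ?_ ⟨hℓ.le, le_rfl⟩
  filter_upwards [hv, ae_restrict_mem measurableSet_Ioo] with x hx hxI
  have := hf0 x (Ioo_subset_Icc_self hxI)
  rw [hx]
  field_simp
  ring

lemma memLp_logDeriv (hℓ : 0 < ℓ) (hf : HasL2Deriv ℓ f f') (hf0 : ∀ x ∈ Icc 0 ℓ, f x ≠ 0) :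
    MemLp (fun x => f' x / f x) 2 (volume.restrict (Ioo 0 ℓ)) := by
  simp only [div_eq_inv_mul]
  exact memLp_continuousOn_mul ((hf.continuousOn hℓ).inv₀ hf0) hf.memLp

/-- Integration by parts, with no boundary terms since φ vanishes at both ends. The bracket on the
right is the residual of the second equation of the system. -/
lemma integral_quasi_eq (hℓ : 0 < ℓ) (hf : HasL2Deriv ℓ f f') (hf0 : ∀ x ∈ Icc 0 ℓ, f x ≠ 0)
    (hy : HasL2Deriv ℓ y y') (hv : HasL2Deriv ℓ v v')
    (hφ : HasL2Deriv ℓ φ φ') (hφ0 : φ 0 = 0) (hφℓ : φ ℓ = 0) :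
    (∫ x in (0 : ℝ)..ℓ, v x * φ' x - f' x / f x * v x * φ x) - lam * ∫ x in (0 : ℝ)..ℓ, y x * φ x =
      - ∫ x in (0 : ℝ)..ℓ, (v' x + f' x / f x * v x + lam * y x) * φ x := by
  have hφ2 := memLp_of_continuousOn (hφ.continuousOn hℓ) 2
  have hh := memLp_logDeriv hℓ hf hf0
  have hhv : MemLp (fun x => f' x / f x * v x) 2 (volume.restrict (Ioo 0 ℓ)) := by
    simp only [mul_comm _ (v _)]
    exact memLp_continuousOn_mul (hv.continuousOn hℓ) hh
  have i1 := intervalIntegrable_mul_of_memLp hℓ (memLp_of_continuousOn (hv.continuousOn hℓ) 2)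
    hφ.memLp
  have i2 := intervalIntegrable_mul_of_memLp hℓ hhv hφ2
  have i3 := intervalIntegrable_mul_of_memLp hℓ (memLp_of_continuousOn (hy.continuousOn hℓ) 2) hφ2
  have i4 := intervalIntegrable_mul_of_memLp hℓ hv.memLp hφ2
  have hparts := (hv.mul hℓ hφ).eq_integral ℓ ⟨hℓ.le, le_rfl⟩
  rw [hφ0, hφℓ, mul_zero, mul_zero, zero_add, intervalIntegral.integral_add i4 i1] at hparts
  rw [intervalIntegral.integral_sub i1 i2]
  have : ∀ x, (v' x + f' x / f x * v x + lam * y x) * φ x =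
    v' x * φ x + f' x / f x * v x * φ x + lam * (y x * φ x) := fun x => by ring
  simp only [this]
  rw [intervalIntegral.integral_add (i4.add i2) (i3.const_mul lam),
    intervalIntegral.integral_add i4 i2, intervalIntegral.integral_const_mul]
  linear_combination -hparts

lemma solvesSchrodinger_of_system (hℓ : 0 < ℓ) (hf : HasL2Deriv ℓ f f')
    (hf0 : ∀ x ∈ Icc 0 ℓ, f x ≠ 0)
    (hfs : ∀ φ φ' : ℝ → ℂ, HasL2Deriv ℓ φ φ' → φ 0 = 0 → φ ℓ = 0 →
      (∫ x in (0 : ℝ)..ℓ, f' x * φ' x) - (∫ x in (0 : ℝ)..ℓ, σ x * (f' x * φ x + f x * φ' x)) = 0)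
    (hy : HasL2Deriv ℓ y fun x => f' x / f x * y x + v x)
    (hv : HasL2Deriv ℓ v fun x => -(f' x / f x * v x) - lam * y x) :
    SolvesSchrodinger ℓ σ lam y := by
  refine ⟨_, hy, fun φ φ' hφ hφ0 hφℓ => ?_⟩
  rw [weakForm_eq_integral (v := v) hℓ hf hf0 hfs hy (Eventually.of_forall fun x => by ring)
    hφ hφ0 hφℓ, ← sub_eq_zero, integral_quasi_eq hℓ hf hf0 hy hv hφ hφ0 hφℓ]
  have hz : ∀ x, (-(f' x / f x * v x) - lam * y x + f' x / f x * v x + lam * y x) * φ x = 0 :=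
    fun x => by ring
  simp only [hz, intervalIntegral.integral_zero, neg_zero]

/-- Smooth functions compactly supported in (0,ℓ) are admissible test functions, so the fundamental
lemma of the calculus of variations applies. -/
lemma ae_eq_zero_of_integral_mul_eq_zero (hℓ : 0 < ℓ) {g : ℝ → ℂ}
    (hg : MemLp g 2 (volume.restrict (Ioo 0 ℓ)))
    (h : ∀ φ φ' : ℝ → ℂ, HasL2Deriv ℓ φ φ' → φ 0 = 0 → φ ℓ = 0 →
      ∫ x in (0 : ℝ)..ℓ, g x * φ x = 0) : ∀ᵐ x ∂(volume.restrict (Ioo 0 ℓ)), g x = 0 := by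
  rw [ae_restrict_iff' measurableSet_Ioo]
  refine isOpen_Ioo.ae_eq_zero_of_integral_contDiff_smul_eq_zero
    (IntegrableOn.locallyIntegrableOn (hg.integrable (by norm_num))) fun φ hφ _ hsupp => ?_
  have hz : ∀ x, x ∉ Ioo 0 ℓ → φ x = 0 := fun x hx => by
    by_contra hne
    exact hx (hsupp (subset_tsupport _ hne))
  have hc : ContDiff ℝ 1 (fun x => (φ x : ℂ)) :=
    Complex.ofRealCLM.contDiff.comp (hφ.of_le (by exact_mod_cast le_top))
  have := h _ _ (hasL2Deriv_of_contDiff (ℓ := ℓ) hc) (by simp [hz 0 (by simp)])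
    (by simp [hz ℓ (by simp)])
  rw [intervalIntegral.integral_of_le hℓ.le, integral_Ioc_eq_integral_Ioo] at this
  rw [← this, ← setIntegral_eq_integral_of_forall_compl_eq_zero (s := Ioo 0 ℓ)]
  · simp only [Complex.real_smul, mul_comm]
  · intro x hx
    simp [hz x hx]

/-- By the weak factorization, the L² residual v' + (f'/f)v + lam y is orthogonal to every test
function. -/
lemma ae_eq_of_solvesSchrodinger (hℓ : 0 < ℓ) (hf : HasL2Deriv ℓ f f')
    (hf0 : ∀ x ∈ Icc 0 ℓ, f x ≠ 0)
    (hfs : ∀ φ φ' : ℝ → ℂ, HasL2Deriv ℓ φ φ' → φ 0 = 0 → φ ℓ = 0 →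
      (∫ x in (0 : ℝ)..ℓ, f' x * φ' x) - (∫ x in (0 : ℝ)..ℓ, σ x * (f' x * φ x + f x * φ' x)) = 0)
    (hs : SolvesSchrodinger ℓ σ lam y) (hy : HasL2Deriv ℓ y y') (hv : HasL2Deriv ℓ v v')
    (hvy : ∀ᵐ x ∂(volume.restrict (Ioo 0 ℓ)), v x = y' x - f' x / f x * y x) :
    ∀ᵐ x ∂(volume.restrict (Ioo 0 ℓ)), v' x = -(f' x / f x * v x) - lam * y x := by
  obtain ⟨z', hz, hweak⟩ := hs
  have hvz : ∀ᵐ x ∂(volume.restrict (Ioo 0 ℓ)), v x = z' x - f' x / f x * y x := by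
    filter_upwards [hvy, hy.ae_unique hℓ hz] with x h1 h2
    rw [h1, h2]
  have hm : MemLp (fun x => v' x + f' x / f x * v x + lam * y x) 2 (volume.restrict (Ioo 0 ℓ)) := by
    refine (hv.memLp.add ?_).add ((memLp_of_continuousOn (hy.continuousOn hℓ) 2).const_mul lam)
    simp only [mul_comm _ (v _)]
    exact memLp_continuousOn_mul (hv.continuousOn hℓ) (memLp_logDeriv hℓ hf hf0)
  have := ae_eq_zero_of_integral_mul_eq_zero hℓ hm fun φ φ' hφ hφ0 hφℓ => by
    have h1 := hweak φ φ' hφ hφ0 hφℓ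
    rw [weakForm_eq_integral hℓ hf hf0 hfs hz hvz hφ hφ0 hφℓ, ← sub_eq_zero,
      integral_quasi_eq hℓ hf hf0 hy hv hφ hφ0 hφℓ] at h1
    simpa using h1
  filter_upwards [this] with x hx
  linear_combination hx

lemma eq_zero_of_system (hℓ : 0 < ℓ) {h : ℝ → ℂ} (hh : MemLp h 2 (volume.restrict (Ioo 0 ℓ)))
    (hy : HasL2Deriv ℓ y fun x => h x * y x + v x)
    (hv : HasL2Deriv ℓ v fun x => -(h x * v x) - lam * y x) (hy0 : y 0 = 0) (hv0 : v 0 = 0) :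
    ∀ x ∈ Icc 0 ℓ, y x = 0 := by
  -- This weight bounds the sum of the norms of the two right-hand sides by (‖h‖ + 1 + ‖lam‖)(‖y‖ +
  -- ‖v‖).
  have hk : MemLp (fun x => ‖h x‖ + (1 + ‖lam‖)) 2 (volume.restrict (Ioo 0 ℓ)) :=
    hh.norm.add (memLp_const _)
  have hcy := hy.continuousOn hℓ
  have hcv := hv.continuousOn hℓ
  have := eq_zero_of_le_integral_mul hℓ hk (N := fun x => ‖y x‖ + ‖v x‖)
    (hcy.norm.add hcv.norm) (fun x _ => by positivity) fun x hx => ?_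
  · intro x hx
    have h1 := this x hx
    have h2 := norm_nonneg (y x)
    have h3 := norm_nonneg (v x)
    exact norm_eq_zero.1 (by linarith)
  have hsub : uIcc 0 x ⊆ uIcc 0 ℓ := by
    rw [uIcc_of_le hℓ.le, uIcc_of_le hx.1]; exact Icc_subset_Icc_right hx.2
  have iy := ((hy.intervalIntegrable hℓ).mono_set hsub).norm
  have iv := ((hv.intervalIntegrable hℓ).mono_set hsub).norm
  have e1 : ‖y x‖ ≤ ∫ s in (0 : ℝ)..x, ‖h s * y s + v s‖ := by
    rw [hy.eq_integral x hx, hy0, zero_add]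
    exact intervalIntegral.norm_integral_le_integral_norm hx.1
  have e2 : ‖v x‖ ≤ ∫ s in (0 : ℝ)..x, ‖-(h s * v s) - lam * y s‖ := by
    rw [hv.eq_integral x hx, hv0, zero_add]
    exact intervalIntegral.norm_integral_le_integral_norm hx.1
  refine (add_le_add e1 e2).trans ?_
  rw [← intervalIntegral.integral_add iy iv]
  refine intervalIntegral.integral_mono_on hx.1 (iy.add iv) ?_ fun s _ => ?_
  · refine IntervalIntegrable.mul_continuousOn ?_ ?_
    · exact (intervalIntegrable_of_memLp hℓ (by norm_num) hk).norm.mono_set hsub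
    · refine (hcy.norm.add hcv.norm).mono ?_
      rwa [← uIcc_of_le hℓ.le]
  · rw [Real.norm_of_nonneg (by positivity : 0 ≤ ‖h s‖ + (1 + ‖lam‖))]
    have a1 := norm_add_le (h s * y s) (v s)
    have a2 := norm_sub_le (-(h s * v s)) (lam * y s)
    rw [norm_neg] at a2
    rw [norm_mul] at a1 a2
    rw [norm_mul] at a2
    have a3 : 0 ≤ ‖lam‖ * ‖v s‖ := by positivity
    have a4 := norm_nonneg (y s)
    nlinarith

/-- Both functions solve the same system after the derivatives of `f` in their definitions are
identified almost everywhere; the difference has zero initial data. -/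
lemma IsExpSolution.eqOn (hℓ : 0 < ℓ) (hf : IsNonvanishingSolution ℓ σ f) {ρ : ℂ} {y₁ y₂ : ℝ → ℂ}
    (h₁ : IsExpSolution ℓ σ f ρ y₁) (h₂ : IsExpSolution ℓ σ f ρ y₂) : EqOn y₁ y₂ (Icc 0 ℓ) := by
  obtain ⟨f', hf', hfs⟩ := hf.solves
  simp only [zero_mul] at hfs
  have key : ∀ y, IsExpSolution ℓ σ f ρ y → ∃ v, v 0 = Complex.I * ρ ∧
      HasL2Deriv ℓ y (fun x => f' x / f x * y x + v x) ∧
      HasL2Deriv ℓ v (fun x => -(f' x / f x * v x) - ρ ^ 2 * y x) := by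
    intro y hy
    obtain ⟨v, ⟨⟨g', y', hg, hy', hvy⟩, v', hv'⟩, hv0⟩ := hy.init_quasi
    have hvy' : ∀ᵐ x ∂(volume.restrict (Ioo 0 ℓ)), v x = y' x - f' x / f x * y x := by
      filter_upwards [hvy, hg.ae_unique hℓ hf'] with x h1 h2
      rw [h1, h2]
    refine ⟨v, hv0, hy'.congr_deriv ?_, hv'.congr_deriv
      (ae_eq_of_solvesSchrodinger hℓ hf' hf.ne_zero hfs hy.solves hy' hv' hvy')⟩
    filter_upwards [hvy'] with x hx
    rw [hx]; ring
  obtain ⟨v₁, a1, b1, c1⟩ := key y₁ h₁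
  obtain ⟨v₂, a2, b2, c2⟩ := key y₂ h₂
  have := eq_zero_of_system (lam := ρ ^ 2) hℓ (memLp_logDeriv hℓ hf' hf.ne_zero)
    (y := fun x => y₁ x - y₂ x) (v := fun x => v₁ x - v₂ x)
    ((b1.sub hℓ b2).congr_deriv (Eventually.of_forall fun x => by ring))
    ((c1.sub hℓ c2).congr_deriv (Eventually.of_forall fun x => by ring))
    (by simp [h₁.init, h₂.init]) (by simp [a1, a2])
  exact fun x hx => sub_eq_zero.1 (this x hx)

/-- The coefficient is allowed to equal f'/f only almost everywhere, so that a measurable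
representative extended by zero can be used. -/
lemma isExpSolution_of_system (hℓ : 0 < ℓ) (hf : IsNonvanishingSolution ℓ σ f)
    (hf' : HasL2Deriv ℓ f f') {h : ℝ → ℂ}
    (hh : ∀ᵐ x ∂(volume.restrict (Ioo 0 ℓ)), h x = f' x / f x) {ρ : ℂ}
    (hy : HasL2Deriv ℓ y fun x => h x * y x + v x)
    (hv : HasL2Deriv ℓ v fun x => -(h x * v x) - ρ ^ 2 * y x) (hy0 : y 0 = 1)
    (hv0 : v 0 = Complex.I * ρ) : IsExpSolution ℓ σ f ρ y := by
  obtain ⟨g', hg, hgs⟩ := hf.solves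
  simp only [zero_mul] at hgs
  have hh' : ∀ᵐ x ∂(volume.restrict (Ioo 0 ℓ)), h x = g' x / f x := by
    filter_upwards [hh, hg.ae_unique hℓ hf'] with x h1 h2
    rw [h1, h2]
  have hy' : HasL2Deriv ℓ y fun x => g' x / f x * y x + v x := hy.congr_deriv <| by
    filter_upwards [hh'] with x hx
    rw [hx]
  have hv' : HasL2Deriv ℓ v fun x => -(g' x / f x * v x) - ρ ^ 2 * y x := hv.congr_deriv <| by
    filter_upwards [hh'] with x hx
    rw [hx]
  exact ⟨solvesSchrodinger_of_system hℓ hg hf.ne_zero hgs hy' hv', hy0,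
    v, ⟨⟨g', _, hg, hy', Eventually.of_forall fun x => by ring⟩, _, hv'⟩, hv0⟩

end Factorization

/-! ### The Volterra equation for S, solved by iteration. -/

/-- A measurable square-integrable coefficient supported in `(0, ℓ)`. -/
structure IsCoefficient (ℓ : ℝ) (h : ℝ → ℂ) : Prop where
  measurable : Measurable h
  memLp : MemLp h 2 volume
  eq_zero : ∀ x, x ∉ Ioo 0 ℓ → h x = 0

/-- The Volterra operator `φ ↦ ∫_0^x h(s) φ(s, 2s - t) ds`. -/
noncomputable def volterraOp (h : ℝ → ℂ) (φ : ℝ × ℝ → ℂ) (p : ℝ × ℝ) : ℂ :=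
  ∫ s in Ioc 0 p.1, h s * φ (s, 2 * s - p.2)

/-- The function `h(t/2)/2` on `0 ≤ t ≤ 2x`, extended by zero. -/
noncomputable def volterraSource (h : ℝ → ℂ) : ℝ × ℝ → ℂ :=
  indicator {p | 0 ≤ p.2 ∧ p.2 ≤ 2 * p.1} fun p => h (p.2 / 2) / 2

/-- The iterates of the Volterra operator on the source term. -/
noncomputable def volterraIter (h : ℝ → ℂ) : ℕ → ℝ × ℝ → ℂ
  | 0 => volterraOp h (volterraSource h)
  | n + 1 => volterraOp h (volterraIter h n)

/-- The sum of the iterates. -/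
noncomputable def volterraRemainder (h : ℝ → ℂ) (p : ℝ × ℝ) : ℂ := ∑' n, volterraIter h n p

/-- The solution `S` of `S(x,t) = h(t/2)/2 + ∫_0^x h(s) S(s, 2s - t) ds`. -/
noncomputable def volterraKernel (h : ℝ → ℂ) (p : ℝ × ℝ) : ℂ :=
  volterraSource h p + volterraRemainder h p

section Volterra

variable {ℓ : ℝ} {h : ℝ → ℂ} {φ : ℝ × ℝ → ℂ}

lemma IsCoefficient.neg (hh : IsCoefficient ℓ h) : IsCoefficient ℓ fun x => -h x :=
  ⟨hh.measurable.neg, hh.memLp.neg, fun x hx => by rw [hh.eq_zero x hx, neg_zero]⟩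

lemma IsCoefficient.integrable (hh : IsCoefficient ℓ h) : Integrable h := by
  refine IntegrableOn.integrable_of_forall_notMem_eq_zero (s := Ioo 0 ℓ) ?_ hh.eq_zero
  exact (hh.memLp.restrict (Ioo 0 ℓ)).integrable (by norm_num)

lemma measurable_volterraOp (hh : Measurable h) (hφ : Measurable φ) :
    Measurable (volterraOp h φ) := by
  have : volterraOp h φ = fun p : ℝ × ℝ => ∫ s, indicator {q : (ℝ × ℝ) × ℝ | 0 < q.2 ∧ q.2 ≤ q.1.1}
      (fun q => h q.2 * φ (q.2, 2 * q.2 - q.1.2)) (p, s) := by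
    ext p
    rw [volterraOp, ← integral_indicator measurableSet_Ioc]
    rfl
  rw [this]
  have hm : Measurable (indicator {q : (ℝ × ℝ) × ℝ | 0 < q.2 ∧ q.2 ≤ q.1.1}
      (fun q => h q.2 * φ (q.2, 2 * q.2 - q.1.2))) := by
    refine Measurable.indicator ?_ ?_
    · exact (hh.comp measurable_snd).mul (hφ.comp (by fun_prop))
    · exact (measurableSet_lt measurable_const measurable_snd).inter
        (measurableSet_le measurable_snd (measurable_fst.comp measurable_fst))
  exact (hm.stronglyMeasurable.integral_prod_right').measurable

lemma measurable_volterraSource (hh : Measurable h) : Measurable (volterraSource h) := by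
  refine Measurable.indicator ((hh.comp (measurable_snd.div_const 2)).div_const 2) ?_
  exact (measurableSet_le measurable_const measurable_snd).inter
    (measurableSet_le measurable_snd (measurable_fst.const_mul 2))

lemma measurable_volterraIter (hh : Measurable h) (n : ℕ) : Measurable (volterraIter h n) := by
  induction n with
  | zero => exact measurable_volterraOp hh (measurable_volterraSource hh)
  | succ n ih => exact measurable_volterraOp hh ih

/-- The reflection t ↦ 2s - t preserves [0,2s], and s ≤ x, so support in 0 ≤ t ≤ 2x is preserved. -/
lemma volterraOp_eq_zero (hφ : ∀ p : ℝ × ℝ, ¬ (0 ≤ p.2 ∧ p.2 ≤ 2 * p.1) → φ p = 0) (p : ℝ × ℝ)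
    (hp : ¬ (0 ≤ p.2 ∧ p.2 ≤ 2 * p.1)) : volterraOp h φ p = 0 := by
  refine setIntegral_eq_zero_of_forall_eq_zero fun s hs => ?_
  rw [hφ, mul_zero]
  rintro ⟨h1, h2⟩
  refine hp ⟨?_, ?_⟩ <;> dsimp only at h1 h2 <;> linarith [hs.2]

lemma volterraSource_eq_zero (p : ℝ × ℝ) (hp : ¬ (0 ≤ p.2 ∧ p.2 ≤ 2 * p.1)) :
    volterraSource h p = 0 :=
  indicator_of_notMem (s := {p : ℝ × ℝ | 0 ≤ p.2 ∧ p.2 ≤ 2 * p.1}) hp _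

lemma volterraIter_eq_zero (n : ℕ) (p : ℝ × ℝ) (hp : ¬ (0 ≤ p.2 ∧ p.2 ≤ 2 * p.1)) :
    volterraIter h n p = 0 := by
  induction n generalizing p with
  | zero => exact volterraOp_eq_zero volterraSource_eq_zero p hp
  | succ n ih => exact volterraOp_eq_zero ih p hp

lemma volterraRemainder_eq_zero (p : ℝ × ℝ) (hp : ¬ (0 ≤ p.2 ∧ p.2 ≤ 2 * p.1)) :
    volterraRemainder h p = 0 := by
  simp [volterraRemainder, volterraIter_eq_zero _ p hp]

lemma volterraKernel_eq_zero (p : ℝ × ℝ) (hp : ¬ (0 ≤ p.2 ∧ p.2 ≤ 2 * p.1)) :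
    volterraKernel h p = 0 := by
  rw [volterraKernel, volterraSource_eq_zero p hp, volterraRemainder_eq_zero p hp, add_zero]

/-- Since `h` vanishes beyond ℓ, values at x > ℓ are those at ℓ; bounds on [0,ℓ] thus become global.
-/
lemma volterraOp_min (hh : IsCoefficient ℓ h) (p : ℝ × ℝ) :
    volterraOp h φ p = volterraOp h φ (min p.1 ℓ, p.2) := by
  rw [volterraOp, volterraOp, ← integral_indicator measurableSet_Ioc,
    ← integral_indicator measurableSet_Ioc]
  congr 1
  ext s
  by_cases hs : s ∈ Ioo 0 ℓ
  · have : s ∈ Ioc 0 p.1 ↔ s ∈ Ioc 0 (min p.1 ℓ) := by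
      simp only [mem_Ioc, le_min_iff, hs.2.le, and_true]
    by_cases hs1 : s ∈ Ioc 0 p.1
    · rw [indicator_of_mem hs1, indicator_of_mem (this.1 hs1)]
    · rw [indicator_of_notMem hs1, indicator_of_notMem (fun h => hs1 (this.2 h))]
  · simp [indicator, hh.eq_zero s hs]

lemma norm_volterraSource_le (p : ℝ × ℝ) : ‖volterraSource h p‖ ≤ ‖h (p.2 / 2)‖ := by
  rw [volterraSource]
  refine (norm_indicator_le_norm_self _ _).trans ?_
  rw [norm_div, Complex.norm_ofNat]
  linarith [norm_nonneg (h (p.2 / 2))]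

lemma integrable_mul_volterraSource (hh : IsCoefficient ℓ h) (t : ℝ) :
    Integrable fun s => h s * volterraSource h (s, 2 * s - t) := by
  have h1 : MemLp (fun s => h (s - t / 2)) 2 volume :=
    hh.memLp.comp_measurePreserving (measurePreserving_sub_right volume (t / 2))
  refine Integrable.mono (g := fun s => h s * h (s - t / 2)) (hh.memLp.integrable_mul h1) ?_ ?_
  · exact (hh.measurable.mul ((measurable_volterraSource hh.measurable).comp
      (by fun_prop))).aestronglyMeasurable
  · refine Eventually.of_forall fun s => ?_
    rw [norm_mul, norm_mul]
    gcongr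
    refine (norm_volterraSource_le _).trans (le_of_eq ?_)
    congr 2; ring

/-- One application of the operator makes the L² source bounded: the integrand is at most ‖h(s)‖‖h(s
- t/2)‖, a product of two L² functions with equal norms. This is why the iteration starts at the
image of the source. -/
lemma norm_volterraIter_zero_le (hh : IsCoefficient ℓ h) (p : ℝ × ℝ) :
    ‖volterraIter h 0 p‖ ≤ ∫ s, ‖h s‖ ^ 2 := by
  have h1 : MemLp (fun s => h (s - p.2 / 2)) 2 volume :=
    hh.memLp.comp_measurePreserving (measurePreserving_sub_right volume (p.2 / 2))
  have i1 := hh.memLp.norm.integrable_sq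
  have i2 := h1.norm.integrable_sq
  have hT : ∫ s, ‖h (s - p.2 / 2)‖ ^ 2 = ∫ s, ‖h s‖ ^ 2 :=
    integral_sub_right_eq_self (fun s => ‖h s‖ ^ 2) (p.2 / 2)
  calc ‖volterraIter h 0 p‖
      ≤ ∫ s in Ioc 0 p.1, ‖h s * volterraSource h (s, 2 * s - p.2)‖ :=
        norm_integral_le_integral_norm _
    _ ≤ ∫ s, ‖h s * volterraSource h (s, 2 * s - p.2)‖ :=
        setIntegral_le_integral (integrable_mul_volterraSource hh p.2).norm
          (Eventually.of_forall fun s => norm_nonneg _)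
    _ ≤ ∫ s, (1 / 2 * ‖h s‖ ^ 2 + 1 / 2 * ‖h (s - p.2 / 2)‖ ^ 2) := by
        refine integral_mono (integrable_mul_volterraSource hh p.2).norm
          ((i1.const_mul _).add (i2.const_mul _)) fun s => ?_
        have h2 : ‖volterraSource h (s, 2 * s - p.2)‖ ≤ ‖h (s - p.2 / 2)‖ := by
          refine (norm_volterraSource_le _).trans (le_of_eq ?_)
          congr 2; ring
        dsimp only
        rw [norm_mul]
        have h3 := mul_le_mul_of_nonneg_left h2 (norm_nonneg (h s))
        have h4 := sq_nonneg (‖h s‖ - ‖h (s - p.2 / 2)‖)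
        linarith
    _ = ∫ s, ‖h s‖ ^ 2 := by
        rw [integral_add (i1.const_mul _) (i2.const_mul _), integral_const_mul,
          integral_const_mul, hT]
        ring

/-- Each iteration halves the bound in the norm weighted by e^{-λx}; on [0,ℓ] the weight costs at
most the factor e^{λℓ}. -/
lemma exists_norm_volterraIter_le (hℓ : 0 < ℓ) (hh : IsCoefficient ℓ h) :
    ∃ D : ℝ, 0 ≤ D ∧ ∀ n p, ‖volterraIter h n p‖ ≤ D * (1 / 2) ^ n := by
  obtain ⟨lam, hlam, hw⟩ := exists_weight hℓ (hh.memLp.restrict (Ioo 0 ℓ))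
  set J := ∫ s, ‖h s‖ ^ 2
  have hJ : 0 ≤ J := integral_nonneg fun s => sq_nonneg _
  have key : ∀ n, ∀ x ∈ Icc 0 ℓ, ∀ t,
      ‖volterraIter h n (x, t)‖ ≤ J * (1 / 2) ^ n * Real.exp (lam * x) := by
    intro n
    induction n with
    | zero =>
      intro x hx t
      have : 1 ≤ Real.exp (lam * x) := Real.one_le_exp (mul_nonneg hlam.le hx.1)
      rw [pow_zero, mul_one]
      exact (norm_volterraIter_zero_le hh _).trans (le_mul_of_one_le_right hJ this)
    | succ n ih =>
      intro x hx t
      have hi : IntegrableOn (fun s => ‖h s‖ * Real.exp (lam * s)) (Ioc 0 x) := by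
        have := (hh.integrable.norm.intervalIntegrable (a := 0) (b := x)).mul_continuousOn
          (g := fun s => Real.exp (lam * s)) (by fun_prop)
        rwa [intervalIntegrable_iff_integrableOn_Ioc_of_le hx.1] at this
      have h1 : ‖volterraIter h (n + 1) (x, t)‖ ≤
          ∫ s in Ioc 0 x, J * (1 / 2) ^ n * (‖h s‖ * Real.exp (lam * s)) := by
        refine norm_integral_le_of_norm_le (hi.const_mul _) ?_
        filter_upwards [ae_restrict_mem measurableSet_Ioc] with s hs
        rw [norm_mul, mul_left_comm]
        gcongr
        exact ih s ⟨hs.1.le, hs.2.trans hx.2⟩ _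
      refine h1.trans ?_
      have h2 := hw x hx
      rw [intervalIntegral.integral_of_le hx.1] at h2
      rw [integral_const_mul, pow_succ, mul_assoc, mul_assoc, mul_assoc]
      gcongr
  refine ⟨J * Real.exp (lam * ℓ), by positivity, fun n p => ?_⟩
  have hmin : volterraIter h n p = volterraIter h n (min p.1 ℓ, p.2) := by
    cases n <;> exact volterraOp_min hh p
  by_cases hp : 0 ≤ p.1
  · rw [hmin, mul_right_comm]
    refine (key n _ ⟨le_min hp hℓ.le, min_le_right _ _⟩ _).trans ?_
    gcongr
    exact min_le_right _ _
  · rw [volterraIter_eq_zero n p fun h => hp (by linarith [h.1, h.2]), norm_zero]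
    positivity

lemma summable_volterraIter (hℓ : 0 < ℓ) (hh : IsCoefficient ℓ h) (p : ℝ × ℝ) :
    Summable fun n => volterraIter h n p := by
  obtain ⟨D, -, hD⟩ := exists_norm_volterraIter_le hℓ hh
  exact Summable.of_norm_bounded (summable_geometric_two.mul_left D) fun n => hD n p

lemma measurable_volterraRemainder (hℓ : 0 < ℓ) (hh : IsCoefficient ℓ h) :
    Measurable (volterraRemainder h) := by
  refine measurable_of_tendsto_metrizable (f := fun N p => ∑ n ∈ Finset.range N, volterraIter h n p)
    (fun N => Finset.measurable_fun_sum _ fun n _ => measurable_volterraIter hh.measurable n) ?_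
  rw [tendsto_pi_nhds]
  exact fun p => (summable_volterraIter hℓ hh p).hasSum.tendsto_sum_nat

lemma measurable_volterraKernel (hℓ : 0 < ℓ) (hh : IsCoefficient ℓ h) :
    Measurable (volterraKernel h) :=
  (measurable_volterraSource hh.measurable).add (measurable_volterraRemainder hℓ hh)

lemma exists_norm_volterraRemainder_le (hℓ : 0 < ℓ) (hh : IsCoefficient ℓ h) :
    ∃ D : ℝ, 0 ≤ D ∧ ∀ p, ‖volterraRemainder h p‖ ≤ D := by
  obtain ⟨D, hD0, hD⟩ := exists_norm_volterraIter_le hℓ hh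
  refine ⟨D * 2, by positivity, fun p => ?_⟩
  exact tsum_of_norm_bounded (hasSum_geometric_two.mul_left D) fun n => hD n p

lemma integrable_mul_of_norm_le (hh : IsCoefficient ℓ h) (hφ : Measurable φ) {D : ℝ}
    (hD : ∀ p, ‖φ p‖ ≤ D) (t : ℝ) : Integrable fun s => h s * φ (s, 2 * s - t) :=
  hh.integrable.mul_bdd (c := D) ((hφ.comp (by fun_prop : Measurable fun s : ℝ =>
    (s, 2 * s - t))).aestronglyMeasurable) (Eventually.of_forall fun _ => hD _)

lemma volterraRemainder_eq (hℓ : 0 < ℓ) (hh : IsCoefficient ℓ h) (p : ℝ × ℝ) :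
    volterraRemainder h p = volterraIter h 0 p + volterraOp h (volterraRemainder h) p := by
  obtain ⟨D, hD0, hD⟩ := exists_norm_volterraIter_le hℓ hh
  have hi : ∀ n, Integrable (fun s => h s * volterraIter h n (s, 2 * s - p.2))
      (volume.restrict (Ioc 0 p.1)) := fun n =>
    (integrable_mul_of_norm_le hh (measurable_volterraIter hh.measurable n) (hD n) p.2).restrict
  have hs : Summable fun n => ∫ s in Ioc 0 p.1, ‖h s * volterraIter h n (s, 2 * s - p.2)‖ := by
    refine Summable.of_nonneg_of_le (fun n => integral_nonneg fun s => norm_nonneg _) (fun n => ?_)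
      (summable_geometric_two.mul_left ((∫ s in Ioc 0 p.1, ‖h s‖) * D))
    rw [mul_assoc, ← integral_mul_const]
    refine integral_mono (hi n).norm (hh.integrable.restrict.norm.mul_const _) fun s => ?_
    dsimp only
    rw [norm_mul]
    gcongr
    exact hD n _
  have := hasSum_integral_of_summable_integral_norm hi hs
  have h2 : volterraOp h (volterraRemainder h) p = ∑' n, volterraIter h (n + 1) p := by
    rw [volterraOp]
    simp only [volterraRemainder, ← tsum_mul_left]
    exact this.tsum_eq.symm
  rw [h2, volterraRemainder, (summable_volterraIter hℓ hh p).tsum_eq_zero_add]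

/-- Adding the source to both sides gives the Volterra equation for `volterraKernel`. -/
lemma volterraOp_volterraKernel (hℓ : 0 < ℓ) (hh : IsCoefficient ℓ h) :
    volterraOp h (volterraKernel h) = volterraRemainder h := by
  ext p
  obtain ⟨D, hD0, hD⟩ := exists_norm_volterraRemainder_le hℓ hh
  rw [volterraRemainder_eq hℓ hh, volterraIter, volterraOp, volterraOp, volterraOp,
    ← integral_add (integrable_mul_volterraSource hh p.2).restrict
    (integrable_mul_of_norm_le hh (measurable_volterraRemainder hℓ hh) hD p.2).restrict]
  simp only [volterraKernel, mul_add]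

end Volterra

/-! ### Slice bounds, and the Fourier transform of S in t. -/

section Slices

variable {ℓ : ℝ} {h : ℝ → ℂ}

lemma memLp_comp_div_two {p : ENNReal} (hh : MemLp h p volume) :
    MemLp (fun t : ℝ => h (t / 2)) p volume := by
  have hmap : Measure.map (fun t : ℝ => t / 2) volume = ENNReal.ofReal 2 • volume := by
    have := Real.map_volume_mul_right (a := (2 : ℝ)⁻¹) (by norm_num)
    simpa [div_eq_mul_inv] using this
  refine MemLp.comp_of_map (g := h) (f := fun t : ℝ => t / 2) ?_ (by fun_prop)
  rw [hmap]
  exact hh.smul_measure ENNReal.ofReal_ne_top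

/-- The source is dominated by h(t/2), independently of x, and the remainder by a constant on
[0,2ℓ]. Used for p = 1 and p = 2. -/
lemma exists_eLpNorm_volterraKernel_le (hℓ : 0 < ℓ) (hh : IsCoefficient ℓ h) {p : ENNReal}
    (hp : 1 ≤ p) (hhp : MemLp h p volume) :
    ∃ C : ENNReal, C ≠ ⊤ ∧ ∀ x ≤ ℓ, eLpNorm (fun t => volterraKernel h (x, t)) p volume ≤ C := by
  obtain ⟨D, hD0, hD⟩ := exists_norm_volterraRemainder_le hℓ hh
  have h1 := memLp_comp_div_two hhp
  have h2 : MemLp (indicator (Icc 0 (2 * ℓ)) fun _ : ℝ => D) p volume :=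
    memLp_indicator_const p measurableSet_Icc D
      (Or.inr (by rw [Real.volume_Icc]; exact ENNReal.ofReal_ne_top))
  refine ⟨eLpNorm (fun t : ℝ => h (t / 2)) p volume +
    eLpNorm (indicator (Icc 0 (2 * ℓ)) fun _ : ℝ => D) p volume,
    ENNReal.add_ne_top.2 ⟨h1.2.ne, h2.2.ne⟩, fun x hx => ?_⟩
  have m1 : Measurable fun t => volterraSource h (x, t) :=
    (measurable_volterraSource hh.measurable).comp measurable_prodMk_left
  have m2 : Measurable fun t => volterraRemainder h (x, t) :=
    (measurable_volterraRemainder hℓ hh).comp measurable_prodMk_left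
  refine (eLpNorm_add_le m1.aestronglyMeasurable m2.aestronglyMeasurable hp).trans ?_
  gcongr
  · exact eLpNorm_mono fun t => norm_volterraSource_le _
  · refine eLpNorm_mono_real fun t => ?_
    by_cases ht : 0 ≤ t ∧ t ≤ 2 * x
    · rw [indicator_of_mem (show t ∈ Icc 0 (2 * ℓ) from ⟨ht.1, by linarith [ht.2]⟩)]
      exact hD _
    · rw [volterraRemainder_eq_zero _ ht, norm_zero]
      exact indicator_nonneg (fun _ _ => hD0) _

/-- The function `t ↦ S(x,t) e^{iρt}`. -/
noncomputable def kernelExp (h : ℝ → ℂ) (ρ : ℂ) (p : ℝ × ℝ) : ℂ :=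
  volterraKernel h p * Complex.exp (Complex.I * ρ * p.2)

/-- The function `1 + ∫ S(x,t) e^{iρt} dt`. -/
noncomputable def kernelTransform (h : ℝ → ℂ) (ρ : ℂ) (x : ℝ) : ℂ :=
  1 + ∫ t, kernelExp h ρ (x, t)

lemma measurable_kernelExp (hℓ : 0 < ℓ) (hh : IsCoefficient ℓ h) (ρ : ℂ) :
    Measurable (kernelExp h ρ) :=
  (measurable_volterraKernel hℓ hh).mul (by fun_prop)

lemma norm_exp_le (ρ : ℂ) {t T : ℝ} (ht : |t| ≤ T) :
    ‖Complex.exp (Complex.I * ρ * t)‖ ≤ Real.exp (‖ρ‖ * T) := by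
  refine (Complex.norm_exp_le_exp_norm _).trans (Real.exp_le_exp.2 ?_)
  rw [norm_mul, norm_mul, Complex.norm_I, one_mul, Complex.norm_real, Real.norm_eq_abs]
  gcongr

lemma norm_kernelExp_le (ρ : ℂ) {x : ℝ} (hx : x ≤ ℓ) (t : ℝ) :
    ‖kernelExp h ρ (x, t)‖ ≤ Real.exp (‖ρ‖ * (2 * ℓ)) * ‖volterraKernel h (x, t)‖ := by
  by_cases ht : 0 ≤ t ∧ t ≤ 2 * x
  · rw [kernelExp, norm_mul, mul_comm]
    gcongr
    exact norm_exp_le ρ (by rw [abs_of_nonneg ht.1]; linarith [ht.2])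
  · simp [kernelExp, volterraKernel_eq_zero (h := h) (x, t) ht]

lemma exists_integral_norm_kernelExp_le (hℓ : 0 < ℓ) (hh : IsCoefficient ℓ h) (ρ : ℂ) :
    ∃ C : ℝ, 0 ≤ C ∧ ∀ x ≤ ℓ, Integrable (fun t => kernelExp h ρ (x, t)) ∧
      ∫ t, ‖kernelExp h ρ (x, t)‖ ≤ C := by
  obtain ⟨C, hC, hle⟩ := exists_eLpNorm_volterraKernel_le hℓ hh le_rfl
    (memLp_one_iff_integrable.2 hh.integrable)
  refine ⟨Real.exp (‖ρ‖ * (2 * ℓ)) * C.toReal, by positivity, fun x hx => ?_⟩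
  have hm : Measurable fun t => volterraKernel h (x, t) :=
    (measurable_volterraKernel hℓ hh).comp measurable_prodMk_left
  have hi : Integrable fun t => volterraKernel h (x, t) :=
    memLp_one_iff_integrable.1 ⟨hm.aestronglyMeasurable, (hle x hx).trans_lt hC.lt_top⟩
  have hi2 : Integrable (fun t => kernelExp h ρ (x, t)) := by
    refine Integrable.mono' (hi.norm.const_mul (Real.exp (‖ρ‖ * (2 * ℓ))))
      ((measurable_kernelExp hℓ hh ρ).comp measurable_prodMk_left).aestronglyMeasurable
      (Eventually.of_forall fun t => norm_kernelExp_le ρ hx t)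
  refine ⟨hi2, ?_⟩
  calc ∫ t, ‖kernelExp h ρ (x, t)‖
      ≤ ∫ t, Real.exp (‖ρ‖ * (2 * ℓ)) * ‖volterraKernel h (x, t)‖ :=
        integral_mono hi2.norm (hi.norm.const_mul _) fun t => norm_kernelExp_le ρ hx t
    _ ≤ _ := by
        rw [integral_const_mul]
        gcongr
        rw [integral_norm_eq_lintegral_enorm hm.aestronglyMeasurable]
        refine ENNReal.toReal_mono hC ?_
        rw [← eLpNorm_one_eq_lintegral_enorm]
        exact hle x hx

/-- Substitute t = 2s; the Jacobian cancels the factor 1/2 in the source. -/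
lemma integral_volterraSource_mul_exp (ρ : ℂ) {x : ℝ}
    (hx : 0 ≤ x) : ∫ t, volterraSource h (x, t) * Complex.exp (Complex.I * ρ * t) =
      ∫ s in (0 : ℝ)..x, h s * Complex.exp (2 * Complex.I * ρ * s) := by
  have h1 : (fun t : ℝ => volterraSource h (x, t) * Complex.exp (Complex.I * ρ * t)) =
      indicator (Icc 0 (2 * x)) fun t : ℝ =>
        (fun s : ℝ => h s * Complex.exp (2 * Complex.I * ρ * s) / 2) (t / 2) := by
    ext t
    by_cases ht : 0 ≤ t ∧ t ≤ 2 * x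
    · rw [indicator_of_mem (show t ∈ Icc 0 (2 * x) from ht), volterraSource,
        indicator_of_mem (show (x, t) ∈ {p : ℝ × ℝ | 0 ≤ p.2 ∧ p.2 ≤ 2 * p.1} from ht)]
      have : 2 * Complex.I * ρ * ((t / 2 : ℝ) : ℂ) = Complex.I * ρ * t := by push_cast; ring
      dsimp only
      rw [this]
      ring
    · rw [indicator_of_notMem (show t ∉ Icc 0 (2 * x) from ht), volterraSource_eq_zero _ ht,
        zero_mul]
  rw [h1, integral_indicator measurableSet_Icc, integral_Icc_eq_integral_Ioc,
    ← intervalIntegral.integral_of_le (by positivity),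
    intervalIntegral.integral_comp_div
      (fun s : ℝ => h s * Complex.exp (2 * Complex.I * ρ * s) / 2) two_ne_zero, zero_div,
    mul_div_cancel_left₀ _ two_ne_zero, intervalIntegral.integral_div]
  rw [Complex.real_smul]
  push_cast
  field_simp

/-- Fubini together with e^{iρt} = e^{2iρs} e^{-iρ(2s-t)}: the reflection in the Volterra operator
turns ρ into -ρ. -/
lemma integral_volterraRemainder_mul_exp (hℓ : 0 < ℓ) (hh : IsCoefficient ℓ h) (ρ : ℂ) {x : ℝ}
    (hx : x ∈ Icc 0 ℓ) : ∫ t, volterraRemainder h (x, t) * Complex.exp (Complex.I * ρ * t) =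
      ∫ s in (0 : ℝ)..x, h s * Complex.exp (2 * Complex.I * ρ * s) *
        ∫ t, kernelExp h (-ρ) (s, t) := by
  obtain ⟨C, hC0, hC⟩ := exists_integral_norm_kernelExp_le hℓ hh (-ρ)
  set F : ℝ × ℝ → ℂ := fun q => h q.1 * Complex.exp (2 * Complex.I * ρ * q.1) *
    kernelExp h (-ρ) (q.1, 2 * q.1 - q.2)
  have hF : Measurable F := by
    refine ((hh.measurable.comp measurable_fst).mul (by fun_prop)).mul ?_
    exact (measurable_kernelExp hℓ hh (-ρ)).comp (by fun_prop)
  have h1 : ∀ t : ℝ, volterraRemainder h (x, t) * Complex.exp (Complex.I * ρ * t) =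
      ∫ s in Ioc 0 x, F (s, t) := by
    intro t
    rw [← volterraOp_volterraKernel hℓ hh, volterraOp, ← integral_mul_const]
    congr 1
    ext s
    simp only [F, kernelExp]
    have : Complex.exp (Complex.I * ρ * t) = Complex.exp (2 * Complex.I * ρ * s) *
        Complex.exp (Complex.I * -ρ * ((2 * s - t : ℝ) : ℂ)) := by
      rw [← Complex.exp_add]; congr 1; push_cast; ring
    rw [this]; ring
  -- The inner integral of ‖F‖ is at most a constant times ‖h(s)‖, by the L¹ slice bound uniform in
  -- s.
  have hint : Integrable F ((volume.restrict (Ioc 0 x)).prod volume) := by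
    rw [integrable_prod_iff hF.aestronglyMeasurable]
    constructor
    · filter_upwards [ae_restrict_mem measurableSet_Ioc] with s hs
      exact Integrable.const_mul ((hC s (hs.2.trans hx.2)).1.comp_sub_left (2 * s))
        (h s * Complex.exp (2 * Complex.I * ρ * s))
    · refine Integrable.mono' (g := fun s => ‖h s‖ * (Real.exp (‖2 * ρ‖ * ℓ) * C))
        (hh.integrable.norm.mul_const _).restrict
        hF.aestronglyMeasurable.norm.integral_prod_right' ?_
      filter_upwards [ae_restrict_mem measurableSet_Ioc] with s hs
      rw [Real.norm_of_nonneg (integral_nonneg fun t => norm_nonneg _)]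
      simp only [F, norm_mul]
      rw [integral_const_mul,
        integral_sub_left_eq_self (fun t => ‖kernelExp h (-ρ) (s, t)‖) volume (2 * s), mul_assoc]
      have : (2 : ℂ) * Complex.I * ρ * s = Complex.I * (2 * ρ) * s := by ring
      rw [this]
      gcongr
      · rw [← norm_mul]
        exact norm_exp_le _ (by rw [abs_of_pos hs.1]; exact hs.2.trans hx.2)
      · exact (hC s (hs.2.trans hx.2)).2
  simp only [h1]
  rw [integral_integral_swap (f := fun t s => F (s, t)) hint.swap, intervalIntegral.integral_of_le hx.1]
  congr 1
  ext s
  simp only [F]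
  rw [integral_const_mul,
    integral_sub_left_eq_self (fun t => kernelExp h (-ρ) (s, t)) volume (2 * s)]

lemma exists_norm_kernelTransform_le (hℓ : 0 < ℓ) (hh : IsCoefficient ℓ h) (ρ : ℂ) :
    ∃ C : ℝ, ∀ x ≤ ℓ, ‖kernelTransform h ρ x‖ ≤ C := by
  obtain ⟨C, hC0, hC⟩ := exists_integral_norm_kernelExp_le hℓ hh ρ
  refine ⟨1 + C, fun x hx => ?_⟩
  refine (norm_add_le _ _).trans ?_
  rw [norm_one]
  gcongr
  exact (norm_integral_le_integral_norm _).trans (hC x hx).2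

lemma measurable_kernelTransform (hℓ : 0 < ℓ) (hh : IsCoefficient ℓ h) (ρ : ℂ) :
    Measurable (kernelTransform h ρ) :=
  measurable_const.add
    (measurable_kernelExp hℓ hh ρ).stronglyMeasurable.integral_prod_right'.measurable

lemma kernelTransform_eq (hℓ : 0 < ℓ) (hh : IsCoefficient ℓ h) (ρ : ℂ) {x : ℝ}
    (hx : x ∈ Icc 0 ℓ) : kernelTransform h ρ x = 1 + ∫ s in (0 : ℝ)..x,
      h s * Complex.exp (2 * Complex.I * ρ * s) * kernelTransform h (-ρ) s := by
  obtain ⟨C, hC0, hC⟩ := exists_integral_norm_kernelExp_le hℓ hh ρ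
  have i1 : Integrable fun s : ℝ => volterraSource h (x, s) * Complex.exp (Complex.I * ρ * s) := by
    refine Integrable.mono' (((memLp_one_iff_integrable.1
      (memLp_comp_div_two (memLp_one_iff_integrable.2 hh.integrable))).norm).const_mul
        (Real.exp (‖ρ‖ * (2 * ℓ)))) (((measurable_volterraSource hh.measurable).comp
        measurable_prodMk_left).mul (by fun_prop)).aestronglyMeasurable
        (Eventually.of_forall fun t => ?_)
    by_cases ht : 0 ≤ t ∧ t ≤ 2 * x
    · rw [norm_mul, mul_comm]
      gcongr
      · exact norm_exp_le ρ (by rw [abs_of_nonneg ht.1]; linarith [ht.2, hx.2])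
      · exact norm_volterraSource_le _
    · rw [volterraSource_eq_zero _ ht, zero_mul, norm_zero]
      positivity
  have i2 : Integrable fun s : ℝ =>
      volterraRemainder h (x, s) * Complex.exp (Complex.I * ρ * s) := by
    refine ((hC x hx.2).1.sub i1).congr (Eventually.of_forall fun t => ?_)
    simp only [kernelExp, volterraKernel, Pi.sub_apply]
    ring
  have j : IntervalIntegrable (fun s : ℝ => h s * Complex.exp (2 * Complex.I * ρ * s)) volume 0 x :=
    (hh.integrable.intervalIntegrable).mul_continuousOn (by fun_prop)
  have j2 : IntervalIntegrable (fun s : ℝ => h s * Complex.exp (2 * Complex.I * ρ * s) *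
      kernelTransform h (-ρ) s) volume 0 x := by
    obtain ⟨D, hD⟩ := exists_norm_kernelTransform_le hℓ hh (-ρ)
    rw [intervalIntegrable_iff_integrableOn_Ioc_of_le hx.1] at j ⊢
    refine Integrable.mul_bdd (c := D) j
      (measurable_kernelTransform hℓ hh (-ρ)).aestronglyMeasurable ?_
    filter_upwards [ae_restrict_mem measurableSet_Ioc] with s hs
    exact hD s (hs.2.trans hx.2)
  have e : ∫ t, kernelExp h ρ (x, t) =
      (∫ t, volterraSource h (x, t) * Complex.exp (Complex.I * ρ * t)) +
      ∫ t, volterraRemainder h (x, t) * Complex.exp (Complex.I * ρ * t) := by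
    rw [← integral_add i1 i2]
    congr 1; ext t
    simp only [kernelExp, volterraKernel]
    ring
  rw [kernelTransform, e, integral_volterraSource_mul_exp ρ hx.1,
    integral_volterraRemainder_mul_exp hℓ hh ρ hx, ← intervalIntegral.integral_add j]
  · congr 2
    ext s
    rw [kernelTransform]
    ring
  · refine (j2.sub j).congr fun s _ => ?_
    simp only [kernelTransform]
    ring

lemma hasL2Deriv_kernelTransform (hℓ : 0 < ℓ) (hh : IsCoefficient ℓ h) (ρ : ℂ) :
    HasL2Deriv ℓ (kernelTransform h ρ) fun s =>
      h s * Complex.exp (2 * Complex.I * ρ * s) * kernelTransform h (-ρ) s := by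
  have hm : MemLp (fun s : ℝ => h s * Complex.exp (2 * Complex.I * ρ * s) *
      kernelTransform h (-ρ) s) 2 (volume.restrict (Ioo 0 ℓ)) := by
    obtain ⟨D, hD⟩ := exists_norm_kernelTransform_le hℓ hh (-ρ)
    have h1 : MemLp (fun s : ℝ => Complex.exp (2 * Complex.I * ρ * s) * h s) 2
        (volume.restrict (Ioo 0 ℓ)) :=
      memLp_continuousOn_mul (by fun_prop) (hh.memLp.restrict _)
    refine h1.of_le_mul (c := D) ?_ ?_
    · exact ((hh.measurable.mul (by fun_prop)).mul
        (measurable_kernelTransform hℓ hh (-ρ))).aestronglyMeasurable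
    · filter_upwards [ae_restrict_mem measurableSet_Ioo] with s hs
      rw [norm_mul, mul_comm, mul_comm (h s)]
      gcongr
      exact hD s hs.2.le
  refine ⟨hm, fun x hx => ?_⟩
  rw [kernelTransform_eq hℓ hh ρ hx, kernelTransform_eq hℓ hh ρ ⟨le_rfl, hℓ.le⟩]
  simp

/-- The function `e^{-iρx} + ∫ S(x,t) e^{iρ(t-x)} dt`. -/
noncomputable def jostFunction (h : ℝ → ℂ) (ρ : ℂ) (x : ℝ) : ℂ :=
  Complex.exp (-(Complex.I * ρ * x)) * kernelTransform h ρ x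

lemma jostFunction_zero (hℓ : 0 < ℓ) (hh : IsCoefficient ℓ h) (ρ : ℂ) :
    jostFunction h ρ 0 = 1 := by
  simp [jostFunction, kernelTransform_eq hℓ hh ρ ⟨le_rfl, hℓ.le⟩]

/-- The factor e^{-iρx} absorbs the oscillating phase: e^{-iρx}e^{2iρx} = e^{iρx} is the prefactor
of J_{-ρ}. -/
lemma hasL2Deriv_jostFunction (hℓ : 0 < ℓ) (hh : IsCoefficient ℓ h) (ρ : ℂ) :
    HasL2Deriv ℓ (jostFunction h ρ) fun x =>
      -(Complex.I * ρ * jostFunction h ρ x) + h x * jostFunction h (-ρ) x := by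
  have hd : ∀ x : ℝ, HasDerivAt (fun x : ℝ => Complex.exp (-(Complex.I * ρ * x)))
      (-(Complex.I * ρ) * Complex.exp (-(Complex.I * ρ * x))) x := fun x => by
    have := (((Complex.ofRealCLM.hasDerivAt (x := x)).const_mul (Complex.I * ρ)).neg).cexp
    refine this.congr_deriv ?_
    simp [mul_comm]
  have hE : HasL2Deriv ℓ (fun x : ℝ => Complex.exp (-(Complex.I * ρ * x)))
      (fun x : ℝ => -(Complex.I * ρ) * Complex.exp (-(Complex.I * ρ * x))) := by
    have := hasL2Deriv_of_contDiff (ℓ := ℓ) (u := fun x : ℝ => Complex.exp (-(Complex.I * ρ * x)))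
      (Complex.contDiff_exp.comp ((contDiff_const.mul Complex.ofRealCLM.contDiff).neg))
    rwa [show deriv (fun x : ℝ => Complex.exp (-(Complex.I * ρ * x))) = _ from
      funext fun x => (hd x).deriv] at this
  refine (hE.mul hℓ (hasL2Deriv_kernelTransform hℓ hh ρ)).congr_deriv
    (Eventually.of_forall fun x => ?_)
  have : Complex.exp (2 * Complex.I * ρ * x) = Complex.exp (Complex.I * ρ * x) *
      Complex.exp (Complex.I * ρ * x) := by
    rw [← Complex.exp_add]; congr 1; ring
  have h2 : Complex.exp (-(Complex.I * ρ * x)) * Complex.exp (Complex.I * ρ * x) = 1 := by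
    rw [← Complex.exp_add]; simp
  have h3 : -(Complex.I * -ρ * x) = Complex.I * ρ * x := by ring
  simp only [jostFunction, h3]
  rw [this]
  linear_combination (h x * Complex.exp (Complex.I * ρ * x) * kernelTransform h (-ρ) x) * h2

end Slices

/-! ### The transmutation kernel built from S for h and for -h. -/

section Kernel

variable {ℓ : ℝ} {h : ℝ → ℂ}

lemma exists_coefficient {g : ℝ → ℂ} (hg : MemLp g 2 (volume.restrict (Ioo 0 ℓ))) :
    ∃ h, IsCoefficient ℓ h ∧ ∀ᵐ x ∂(volume.restrict (Ioo 0 ℓ)), h x = g x := by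
  refine ⟨indicator (Ioo 0 ℓ) (hg.1.mk g), ⟨?_, ?_, fun x hx => indicator_of_notMem hx _⟩, ?_⟩
  · exact hg.1.stronglyMeasurable_mk.measurable.indicator measurableSet_Ioo
  · rw [memLp_indicator_iff_restrict measurableSet_Ioo]
    exact hg.ae_eq hg.1.ae_eq_mk
  · filter_upwards [hg.1.ae_eq_mk, ae_restrict_mem measurableSet_Ioo] with x h1 h2
    rw [indicator_of_mem h2, h1]

lemma integral_add_add_sub {a b c d : ℝ → ℂ} (ha : Integrable a) (hb : Integrable b)
    (hc : Integrable c) (hd : Integrable d) :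
    ∫ t, (a t + b t + c t - d t) = (∫ t, a t) + (∫ t, b t) + (∫ t, c t) - ∫ t, d t := by
  have hab : Integrable fun t => a t + b t := ha.add hb
  have habc : Integrable fun t => a t + b t + c t := hab.add hc
  rw [integral_sub habc hd, integral_add hab hc, integral_add ha hb]

lemma eLpNorm_half_add_add_sub_le {a b c d : ℝ → ℂ} {p : ENNReal} (hp : 1 ≤ p)
    (ha : AEStronglyMeasurable a) (hb : AEStronglyMeasurable b) (hc : AEStronglyMeasurable c)
    (hd : AEStronglyMeasurable d) :
    eLpNorm (fun t => 1 / 2 * (a t + b t + c t - d t)) p volume ≤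
      eLpNorm a p volume + eLpNorm b p volume + eLpNorm c p volume + eLpNorm d p volume := by
  calc eLpNorm (fun t => 1 / 2 * (a t + b t + c t - d t)) p volume
      ≤ eLpNorm (a + b + c - d) p volume := by
        refine eLpNorm_mono fun t => ?_
        rw [norm_mul]
        refine mul_le_of_le_one_left (norm_nonneg _) ?_
        norm_num
    _ ≤ _ := by
        refine (eLpNorm_sub_le ((ha.add hb).add hc) hd hp).trans ?_
        gcongr
        refine (eLpNorm_add_le (ha.add hb) hc hp).trans ?_
        gcongr
        exact eLpNorm_add_le ha hb hp

lemma eLpNorm_comp_add_left {a : ℝ → ℂ} {p : ENNReal} (ha : AEStronglyMeasurable a) (x : ℝ) :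
    AEStronglyMeasurable (fun t => a (x + t)) ∧
      eLpNorm (fun t => a (x + t)) p volume = eLpNorm a p volume :=
  have hp := measurePreserving_add_left volume x
  ⟨ha.comp_measurePreserving hp, eLpNorm_comp_measurePreserving ha hp⟩

lemma eLpNorm_comp_sub_left {a : ℝ → ℂ} {p : ENNReal} (ha : AEStronglyMeasurable a) (x : ℝ) :
    AEStronglyMeasurable (fun t => a (x - t)) ∧
      eLpNorm (fun t => a (x - t)) p volume = eLpNorm a p volume :=
  have hp := Measure.measurePreserving_sub_left volume x
  ⟨ha.comp_measurePreserving hp, eLpNorm_comp_measurePreserving ha hp⟩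

/-- The combination of `volterraKernel (±h)` representing the exponential solution. -/
noncomputable def expKernel (h : ℝ → ℂ) (x t : ℝ) : ℂ :=
  1 / 2 * (volterraKernel h (x, x + t) + volterraKernel h (x, x - t) +
    volterraKernel (fun s => -h s) (x, x - t) - volterraKernel (fun s => -h s) (x, x + t))

/-- The exponential solution in terms of `jostFunction (±h)`. -/
noncomputable def expSolution (h : ℝ → ℂ) (ρ : ℂ) (x : ℝ) : ℂ :=
  1 / 2 * (jostFunction h ρ x + jostFunction h (-ρ) x +
    jostFunction (fun s => -h s) (-ρ) x - jostFunction (fun s => -h s) ρ x)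

/-- The quasi-derivative of `expSolution`. -/
noncomputable def expSolutionQuasi (h : ℝ → ℂ) (ρ : ℂ) (x : ℝ) : ℂ :=
  1 / 2 * (Complex.I * ρ) * (jostFunction h (-ρ) x - jostFunction h ρ x +
    jostFunction (fun s => -h s) (-ρ) x + jostFunction (fun s => -h s) ρ x)

/-- The sum over ±ρ for h and the difference for -h both acquire the coefficient h on
differentiation, so they may be added to form y. The complementary combinations acquire -h and form
v. -/
lemma hasL2Deriv_expSolution (hℓ : 0 < ℓ) (hh : IsCoefficient ℓ h) (ρ : ℂ) :
    HasL2Deriv ℓ (expSolution h ρ) fun x => h x * expSolution h ρ x + expSolutionQuasi h ρ x := by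
  have h1 := hasL2Deriv_jostFunction hℓ hh ρ
  have h2 := hasL2Deriv_jostFunction hℓ hh (-ρ)
  have h3 := hasL2Deriv_jostFunction hℓ hh.neg (-ρ)
  have h4 := hasL2Deriv_jostFunction hℓ hh.neg ρ
  rw [neg_neg] at h2 h3
  refine ((((h1.add hℓ h2).add hℓ h3).sub hℓ h4).const_mul hℓ (1 / 2)).congr_deriv
    (Eventually.of_forall fun x => ?_)
  simp only [expSolution, expSolutionQuasi]
  ring

lemma hasL2Deriv_expSolutionQuasi (hℓ : 0 < ℓ) (hh : IsCoefficient ℓ h) (ρ : ℂ) :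
    HasL2Deriv ℓ (expSolutionQuasi h ρ) fun x =>
      -(h x * expSolutionQuasi h ρ x) - ρ ^ 2 * expSolution h ρ x := by
  have h1 := hasL2Deriv_jostFunction hℓ hh ρ
  have h2 := hasL2Deriv_jostFunction hℓ hh (-ρ)
  have h3 := hasL2Deriv_jostFunction hℓ hh.neg (-ρ)
  have h4 := hasL2Deriv_jostFunction hℓ hh.neg ρ
  rw [neg_neg] at h2 h3
  refine ((((h2.sub hℓ h1).add hℓ h3).add hℓ h4).const_mul hℓ
    (1 / 2 * (Complex.I * ρ))).congr_deriv (Eventually.of_forall fun x => ?_)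
  simp only [expSolution, expSolutionQuasi]
  linear_combination (1 / 2 * ρ ^ 2 * (jostFunction h ρ x + jostFunction h (-ρ) x +
    jostFunction (fun s => -h s) (-ρ) x - jostFunction (fun s => -h s) ρ x)) * Complex.I_sq

lemma isExpSolution_expSolution {σ f f' : ℝ → ℂ} (hℓ : 0 < ℓ) (hf : IsNonvanishingSolution ℓ σ f)
    (hf' : HasL2Deriv ℓ f f') (hh : IsCoefficient ℓ h)
    (hhf : ∀ᵐ x ∂(volume.restrict (Ioo 0 ℓ)), h x = f' x / f x) (ρ : ℂ) :
    IsExpSolution ℓ σ f ρ (expSolution h ρ) := by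
  refine isExpSolution_of_system hℓ hf hf' hhf (hasL2Deriv_expSolution hℓ hh ρ)
    (hasL2Deriv_expSolutionQuasi hℓ hh ρ) ?_ ?_
  · simp only [expSolution, jostFunction_zero hℓ hh, jostFunction_zero hℓ hh.neg]
    ring
  · simp only [expSolutionQuasi, jostFunction_zero hℓ hh, jostFunction_zero hℓ hh.neg]
    ring

/-- Translating t by x recentres the support from [0,2x] to [-x,x] and absorbs the prefactor; for -ρ
the reflection t ↦ x - t does the same. -/
lemma jostFunction_eq_integral (hℓ : 0 < ℓ) (hh : IsCoefficient ℓ h) (ρ : ℂ) {x : ℝ}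
    (hx : x ≤ ℓ) :
    Integrable (fun t : ℝ => volterraKernel h (x, x + t) * Complex.exp (Complex.I * ρ * t)) ∧
    jostFunction h ρ x = Complex.exp (-(Complex.I * ρ * x)) +
      ∫ t : ℝ, volterraKernel h (x, x + t) * Complex.exp (Complex.I * ρ * t) := by
  obtain ⟨C, -, hC⟩ := exists_integral_norm_kernelExp_le hℓ hh ρ
  have h1 : (fun t : ℝ => volterraKernel h (x, x + t) * Complex.exp (Complex.I * ρ * t)) =
      fun t => Complex.exp (-(Complex.I * ρ * x)) * kernelExp h ρ (x, x + t) := by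
    ext t
    rw [kernelExp, mul_left_comm, ← Complex.exp_add]
    congr 2; push_cast; ring
  rw [h1, integral_const_mul, integral_add_left_eq_self (fun t => kernelExp h ρ (x, t)),
    jostFunction, kernelTransform]
  exact ⟨((hC x hx).1.comp_add_left x).const_mul _, by ring⟩

lemma jostFunction_neg_eq_integral (hℓ : 0 < ℓ) (hh : IsCoefficient ℓ h) (ρ : ℂ) {x : ℝ}
    (hx : x ≤ ℓ) :
    Integrable (fun t : ℝ => volterraKernel h (x, x - t) * Complex.exp (Complex.I * ρ * t)) ∧
    jostFunction h (-ρ) x = Complex.exp (Complex.I * ρ * x) +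
      ∫ t : ℝ, volterraKernel h (x, x - t) * Complex.exp (Complex.I * ρ * t) := by
  obtain ⟨C, -, hC⟩ := exists_integral_norm_kernelExp_le hℓ hh (-ρ)
  have h1 : (fun t : ℝ => volterraKernel h (x, x - t) * Complex.exp (Complex.I * ρ * t)) =
      fun t => Complex.exp (Complex.I * ρ * x) * kernelExp h (-ρ) (x, x - t) := by
    ext t
    rw [kernelExp, mul_left_comm, ← Complex.exp_add]
    congr 2; push_cast; ring
  have h2 : -(Complex.I * -ρ * x) = Complex.I * ρ * x := by ring
  rw [h1, integral_const_mul,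
    integral_sub_left_eq_self (fun t => kernelExp h (-ρ) (x, t)) volume x,
    jostFunction, kernelTransform, h2]
  exact ⟨((hC x hx).1.comp_sub_left x).const_mul _, by ring⟩

lemma expKernel_eq_zero {x t : ℝ} (ht : t ∉ Icc (-x) x) : expKernel h x t = 0 := by
  have h1 : ¬ (0 ≤ x + t ∧ x + t ≤ 2 * x) := fun h => ht ⟨by linarith [h.1], by linarith [h.2]⟩
  have h2 : ¬ (0 ≤ x - t ∧ x - t ≤ 2 * x) := fun h => ht ⟨by linarith [h.2], by linarith [h.1]⟩
  simp only [expKernel, volterraKernel_eq_zero (x, x + t) h1, volterraKernel_eq_zero (x, x - t) h2]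
  ring

lemma expSolution_eq_transmutation (hℓ : 0 < ℓ) (hh : IsCoefficient ℓ h) (ρ : ℂ) {x : ℝ}
    (hx : x ∈ Icc 0 ℓ) : expSolution h ρ x =
      transmutation (expKernel h) (fun t => Complex.exp (Complex.I * ρ * t)) x := by
  obtain ⟨i1, e1⟩ := jostFunction_eq_integral hℓ hh ρ hx.2
  obtain ⟨i2, e2⟩ := jostFunction_neg_eq_integral hℓ hh ρ hx.2
  obtain ⟨i3, e3⟩ := jostFunction_neg_eq_integral hℓ hh.neg ρ hx.2
  obtain ⟨i4, e4⟩ := jostFunction_eq_integral hℓ hh.neg ρ hx.2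
  have hK : ∀ t : ℝ, expKernel h x t * Complex.exp (Complex.I * ρ * t) =
      1 / 2 * (volterraKernel h (x, x + t) * Complex.exp (Complex.I * ρ * t) +
        volterraKernel h (x, x - t) * Complex.exp (Complex.I * ρ * t) +
        volterraKernel (fun s => -h s) (x, x - t) * Complex.exp (Complex.I * ρ * t) -
        volterraKernel (fun s => -h s) (x, x + t) * Complex.exp (Complex.I * ρ * t)) :=
    fun t => by rw [expKernel]; ring
  rw [transmutation, intervalIntegral.integral_of_le (by linarith [hx.1]),
    ← integral_Icc_eq_integral_Ioc, setIntegral_eq_integral_of_forall_compl_eq_zero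
      (fun t ht => by rw [expKernel_eq_zero ht, zero_mul])]
  simp only [hK]
  rw [integral_const_mul, integral_add_add_sub i1 i2 i3 i4, expSolution, e1, e2, e3, e4]
  ring

lemma measurable_expKernel (hℓ : 0 < ℓ) (hh : IsCoefficient ℓ h) :
    Measurable fun p : ℝ × ℝ => expKernel h p.1 p.2 := by
  have m1 := measurable_volterraKernel hℓ hh
  have m2 := measurable_volterraKernel hℓ hh.neg
  have a1 : Measurable fun p : ℝ × ℝ => (p.1, p.1 + p.2) := by fun_prop
  have a2 : Measurable fun p : ℝ × ℝ => (p.1, p.1 - p.2) := by fun_prop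
  exact ((((m1.comp a1).add (m1.comp a2)).add (m2.comp a2)).sub (m2.comp a1)).const_mul _

lemma exists_eLpNorm_expKernel_le (hℓ : 0 < ℓ) (hh : IsCoefficient ℓ h) {p : ENNReal}
    (hp : 1 ≤ p) (hhp : MemLp h p volume) :
    ∃ C : ENNReal, C ≠ ⊤ ∧ ∀ x ≤ ℓ, eLpNorm (expKernel h x) p volume ≤ C := by
  obtain ⟨C₁, hC₁, h₁⟩ := exists_eLpNorm_volterraKernel_le hℓ hh hp hhp
  obtain ⟨C₂, hC₂, h₂⟩ := exists_eLpNorm_volterraKernel_le hℓ hh.neg hp hhp.neg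
  refine ⟨C₁ + C₁ + C₂ + C₂, by simp [hC₁, hC₂], fun x hx => ?_⟩
  have m : ∀ g, IsCoefficient ℓ g → AEStronglyMeasurable (fun t => volterraKernel g (x, t)) volume :=
    fun g hg => ((measurable_volterraKernel hℓ hg).comp measurable_prodMk_left).aestronglyMeasurable
  obtain ⟨a1, a2⟩ := eLpNorm_comp_add_left (p := p) (m h hh) x
  obtain ⟨a3, a4⟩ := eLpNorm_comp_sub_left (p := p) (m h hh) x
  obtain ⟨b1, b2⟩ := eLpNorm_comp_add_left (p := p) (m _ hh.neg) x
  obtain ⟨b3, b4⟩ := eLpNorm_comp_sub_left (p := p) (m _ hh.neg) x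
  have key := eLpNorm_half_add_add_sub_le hp a1 a3 b3 b1
  rw [a2, a4, b4, b2] at key
  exact key.trans (add_le_add (add_le_add (add_le_add (h₁ x hx) (h₁ x hx)) (h₂ x hx)) (h₂ x hx))

lemma measurable_expKernel_slice (hℓ : 0 < ℓ) (hh : IsCoefficient ℓ h) (x : ℝ) :
    Measurable (expKernel h x) :=
  Measurable.of_uncurry_left (f := expKernel h) (measurable_expKernel hℓ hh)

lemma memLp_expKernel_slice (hℓ : 0 < ℓ) (hh : IsCoefficient ℓ h) {x : ℝ} (hx : x ≤ ℓ) :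
    MemLp (expKernel h x) 2 volume := by
  obtain ⟨C, hC, hle⟩ := exists_eLpNorm_expKernel_le hℓ hh (by norm_num) hh.memLp
  exact ⟨(measurable_expKernel_slice hℓ hh x).aestronglyMeasurable, (hle x hx).trans_lt hC.lt_top⟩

/-- Tonelli: the L² norms of the slices are bounded uniformly over x in [0,ℓ]. -/
lemma memLp_expKernel_triangle (hℓ : 0 < ℓ) (hh : IsCoefficient ℓ h) :
    MemLp (fun p : ℝ × ℝ => expKernel h p.1 p.2) 2 (volume.restrict (triangle ℓ)) := by
  obtain ⟨C, hC, hle⟩ := exists_eLpNorm_expKernel_le hℓ hh (by norm_num) hh.memLp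
  have hm := measurable_expKernel hℓ hh
  refine ⟨hm.aestronglyMeasurable, ?_⟩
  rw [eLpNorm_lt_top_iff_lintegral_rpow_enorm_lt_top two_ne_zero ENNReal.ofNat_ne_top]
  have hsub : triangle ℓ ⊆ Icc 0 ℓ ×ˢ univ := fun p hp => ⟨⟨hp.1, hp.2.1⟩, mem_univ _⟩
  refine (lintegral_mono_set hsub).trans_lt ?_
  rw [Measure.volume_eq_prod, ← Measure.prod_restrict, Measure.restrict_univ,
    lintegral_prod _ (hm.enorm.pow_const _).aemeasurable]
  calc ∫⁻ x in Icc 0 ℓ, ∫⁻ t, ‖expKernel h x t‖ₑ ^ (2 : ENNReal).toReal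
      ≤ ∫⁻ x in Icc 0 ℓ, C ^ (2 : ENNReal).toReal := by
        refine setLIntegral_mono measurable_const fun x hx => ?_
        have h1 := hle x hx.2
        rw [eLpNorm_eq_lintegral_rpow_enorm_toReal two_ne_zero ENNReal.ofNat_ne_top] at h1
        have h2 := ENNReal.rpow_le_rpow h1 (ENNReal.toReal_nonneg (a := 2))
        rwa [← ENNReal.rpow_mul, one_div, inv_mul_cancel₀ (by simp), ENNReal.rpow_one] at h2
    _ < ⊤ := by
        rw [setLIntegral_const, Real.volume_Icc]
        exact ENNReal.mul_lt_top (ENNReal.rpow_lt_top_of_nonneg (by simp) hC) ENNReal.ofReal_lt_top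

lemma isTransmutationKernel_expKernel {σ f f' : ℝ → ℂ} (hℓ : 0 < ℓ)
    (hf : IsNonvanishingSolution ℓ σ f) (hf' : HasL2Deriv ℓ f f') (hh : IsCoefficient ℓ h)
    (hhf : ∀ᵐ x ∂(volume.restrict (Ioo 0 ℓ)), h x = f' x / f x) :
    IsTransmutationKernel ℓ σ f (expKernel h) :=
  ⟨memLp_expKernel_triangle hℓ hh, fun _ hx => (memLp_expKernel_slice hℓ hh hx.2).restrict _,
    fun ρ => ⟨expSolution h ρ, isExpSolution_expSolution hℓ hf hf' hh hhf ρ,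
      fun _ hx => expSolution_eq_transmutation hℓ hh ρ ⟨hx.1.le, hx.2⟩⟩⟩

lemma exists_integral_norm_expKernel_le (hℓ : 0 < ℓ) (hh : IsCoefficient ℓ h) :
    ∃ C : ℝ, 0 ≤ C ∧ ∀ x ≤ ℓ, Integrable (expKernel h x) ∧ ∫ t, ‖expKernel h x t‖ ≤ C := by
  obtain ⟨C, hC, hle⟩ := exists_eLpNorm_expKernel_le hℓ hh le_rfl
    (memLp_one_iff_integrable.2 hh.integrable)
  refine ⟨C.toReal, ENNReal.toReal_nonneg, fun x hx => ?_⟩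
  have hm := (measurable_expKernel_slice hℓ hh x).aestronglyMeasurable (μ := volume)
  refine ⟨memLp_one_iff_integrable.1 ⟨hm, (hle x hx).trans_lt hC.lt_top⟩, ?_⟩
  rw [integral_norm_eq_lintegral_enorm hm]
  refine ENNReal.toReal_mono hC ?_
  rw [← eLpNorm_one_eq_lintegral_enorm]
  exact hle x hx

end Kernel

/-! ### Density of exponentials, and the bounded operator. -/

section Operator

variable {ℓ : ℝ}

/-- The exponential `t ↦ e^{irt}` on `[-ℓ, ℓ]`. -/
noncomputable def expMap (ℓ r : ℝ) : C(Icc (-ℓ) ℓ, ℂ) :=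
  ⟨fun t => Complex.exp (Complex.I * r * (t : ℝ)), by fun_prop⟩

/-- The star subalgebra of `C[-ℓ, ℓ]` generated by the exponentials. -/
noncomputable def expSubalgebra (ℓ : ℝ) : StarSubalgebra ℂ C(Icc (-ℓ) ℓ, ℂ) where
  toSubalgebra := Algebra.adjoin ℂ (range (expMap ℓ))
  star_mem' := by
    change Algebra.adjoin ℂ (range (expMap ℓ)) ≤ star (Algebra.adjoin ℂ (range (expMap ℓ)))
    refine Algebra.adjoin_le ?_
    rintro - ⟨r, rfl⟩
    refine Algebra.subset_adjoin ⟨-r, ContinuousMap.ext fun t => ?_⟩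
    simp only [expMap, ContinuousMap.coe_mk, ContinuousMap.star_apply, RCLike.star_def,
      ← Complex.exp_conj]
    simp

/-- The exponentials contain 1 and are closed under products, so the algebra they generate is their
linear span. -/
lemma expSubalgebra_coe :
    Subalgebra.toSubmodule (expSubalgebra ℓ).toSubalgebra = Submodule.span ℂ (range (expMap ℓ)) := by
  refine Algebra.adjoin_eq_span_of_subset _ (Subset.trans ?_ Submodule.subset_span)
  intro x hx
  refine Submonoid.closure_induction (fun _ => id) ⟨0, ?_⟩ ?_ hx
  · ext t
    simp [expMap]
  · rintro - - - - ⟨m, rfl⟩ ⟨n, rfl⟩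
    refine ⟨m + n, ?_⟩
    ext t
    simp only [expMap, ContinuousMap.coe_mk, ContinuousMap.mul_apply, ← Complex.exp_add]
    congr 1
    push_cast
    ring

lemma expSubalgebra_separatesPoints : (expSubalgebra ℓ).SeparatesPoints := by
  intro x y hxy
  have hne : (x : ℝ) - y ≠ 0 := fun h => hxy (Subtype.ext (sub_eq_zero.1 h))
  -- At this frequency the values at x and y have ratio e^{iπ} = -1.
  refine ⟨_, ⟨expMap ℓ (Real.pi / (x - y)), Algebra.subset_adjoin ⟨_, rfl⟩, rfl⟩, fun h => ?_⟩
  simp only [expMap, ContinuousMap.coe_mk] at h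
  have h1 : Complex.exp (Real.pi * Complex.I) = 1 := by
    have : (Real.pi : ℂ) * Complex.I = Complex.I * ((Real.pi / (x - y) : ℝ) : ℂ) * ((x : ℝ) : ℂ) -
        Complex.I * ((Real.pi / (x - y) : ℝ) : ℂ) * ((y : ℝ) : ℂ) := by
      have hne' : ((x : ℝ) : ℂ) - ((y : ℝ) : ℂ) ≠ 0 := by exact_mod_cast hne
      push_cast
      field_simp
    rw [this, Complex.exp_sub, h, div_self (Complex.exp_ne_zero _)]
  rw [Complex.exp_pi_mul_I] at h1
  norm_num at h1

lemma dense_span_expMap :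
    Dense (Submodule.span ℂ (range (expMap ℓ)) : Set C(Icc (-ℓ) ℓ, ℂ)) := by
  rw [Submodule.dense_iff_topologicalClosure_eq_top, ← expSubalgebra_coe]
  exact congr_arg (Subalgebra.toSubmodule <| StarSubalgebra.toSubalgebra ·)
    (ContinuousMap.starSubalgebra_topologicalClosure_eq_top_of_separatesPoints (expSubalgebra ℓ)
      expSubalgebra_separatesPoints)

lemma transmutation_congr {K : ℝ → ℝ → ℂ} {u w : ℝ → ℂ} {x : ℝ} (hx : x ∈ Icc 0 ℓ)
    (h : EqOn u w (Icc (-ℓ) ℓ)) : transmutation K u x = transmutation K w x := by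
  rw [transmutation, transmutation, h ⟨by linarith [hx.1, hx.2], hx.2⟩]
  congr 1
  refine intervalIntegral.integral_congr fun t ht => ?_
  rw [uIcc_of_le (by linarith [hx.1])] at ht
  simp only [h (show t ∈ Icc (-ℓ) ℓ from ⟨by linarith [ht.1, hx.2], ht.2.trans hx.2⟩)]

lemma norm_iccExtend_le (hℓ : 0 < ℓ) (u : C(Icc (-ℓ) ℓ, ℂ)) (t : ℝ) :
    ‖IccExtend (neg_le_self hℓ.le) u t‖ ≤ ‖u‖ :=
  u.norm_coe_le_norm _

lemma intervalIntegrable_mul_iccExtend (hℓ : 0 < ℓ) {k : ℝ → ℂ} {x : ℝ}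
    (hk : IntervalIntegrable k volume (-x) x) (u : C(Icc (-ℓ) ℓ, ℂ)) :
    IntervalIntegrable (fun t => k t * IccExtend (neg_le_self hℓ.le) u t) volume (-x) x :=
  hk.mul_continuousOn (u.continuous.Icc_extend').continuousOn

lemma norm_transmutation_le (hℓ : 0 < ℓ) {K : ℝ → ℝ → ℂ} {x : ℝ} (hx : 0 ≤ x)
    (hK : IntervalIntegrable (K x) volume (-x) x) (u : C(Icc (-ℓ) ℓ, ℂ)) :
    ‖transmutation K (IccExtend (neg_le_self hℓ.le) u) x‖ ≤
      (1 + ∫ t in (-x)..x, ‖K x t‖) * ‖u‖ := by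
  rw [add_mul, one_mul, ← intervalIntegral.integral_mul_const]
  refine (norm_add_le _ _).trans (add_le_add (norm_iccExtend_le hℓ u x) ?_)
  refine intervalIntegral.norm_integral_le_of_norm_le (by linarith)
    (Eventually.of_forall fun t _ => ?_) (hK.norm.mul_const _)
  rw [norm_mul]
  gcongr
  exact norm_iccExtend_le hℓ u t

/-- The functional `u ↦ u(x) + ∫_{-x}^{x} K(x,t) u(t) dt` on `C[-ℓ, ℓ]`. -/
noncomputable def transmutationAt (hℓ : 0 < ℓ) (K : ℝ → ℝ → ℂ) {x : ℝ} (hx : 0 ≤ x)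
    (hK : IntervalIntegrable (K x) volume (-x) x) : C(Icc (-ℓ) ℓ, ℂ) →L[ℂ] ℂ :=
  LinearMap.mkContinuous
    { toFun := fun u => transmutation K (IccExtend (neg_le_self hℓ.le) u) x
      map_add' := fun u w => by
        have : ∀ t, IccExtend (neg_le_self hℓ.le) ⇑(u + w) t =
          IccExtend (neg_le_self hℓ.le) u t + IccExtend (neg_le_self hℓ.le) w t := fun _ => rfl
        simp only [transmutation, this, mul_add]
        rw [intervalIntegral.integral_add (intervalIntegrable_mul_iccExtend hℓ hK u)
          (intervalIntegrable_mul_iccExtend hℓ hK w)]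
        ring
      map_smul' := fun c u => by
        have : ∀ t, IccExtend (neg_le_self hℓ.le) ⇑(c • u) t =
          c * IccExtend (neg_le_self hℓ.le) u t := fun _ => rfl
        simp only [transmutation, this, mul_left_comm _ c, intervalIntegral.integral_const_mul,
          RingHom.id_apply, smul_eq_mul]
        ring }
    (1 + ∫ t in (-x)..x, ‖K x t‖) (norm_transmutation_le hℓ hx hK)

lemma transmutationAt_apply (hℓ : 0 < ℓ) {K : ℝ → ℝ → ℂ} {x : ℝ} (hx : 0 ≤ x)
    (hK : IntervalIntegrable (K x) volume (-x) x) (u : C(Icc (-ℓ) ℓ, ℂ)) :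
    transmutationAt hℓ K hx hK u = transmutation K (IccExtend (neg_le_self hℓ.le) u) x := rfl

lemma eqOn_iccExtend_expMap (hℓ : 0 < ℓ) (r : ℝ) :
    EqOn (IccExtend (neg_le_self hℓ.le) (expMap ℓ r)) (fun t => Complex.exp (Complex.I * r * t))
      (Icc (-ℓ) ℓ) := fun t ht => by
  rw [IccExtend_of_mem _ _ ht]
  rfl

/-- Two continuous functionals agreeing on a dense span are equal; real frequencies suffice. -/
lemma transmutation_eq_of_exp (hℓ : 0 < ℓ) {K₁ K₂ : ℝ → ℝ → ℂ} {x : ℝ} (hx : x ∈ Icc 0 ℓ)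
    (h₁ : IntervalIntegrable (K₁ x) volume (-x) x) (h₂ : IntervalIntegrable (K₂ x) volume (-x) x)
    (h : ∀ r : ℝ, transmutation K₁ (fun t => Complex.exp (Complex.I * r * t)) x =
      transmutation K₂ (fun t => Complex.exp (Complex.I * r * t)) x) (u : C(Icc (-ℓ) ℓ, ℂ)) :
    transmutation K₁ (IccExtend (neg_le_self hℓ.le) u) x =
      transmutation K₂ (IccExtend (neg_le_self hℓ.le) u) x := by
  have : transmutationAt hℓ K₁ hx.1 h₁ = transmutationAt hℓ K₂ hx.1 h₂ := by
    refine ContinuousLinearMap.ext_on dense_span_expMap ?_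
    rintro - ⟨r, rfl⟩
    rw [transmutationAt_apply, transmutationAt_apply,
      transmutation_congr hx (eqOn_iccExtend_expMap hℓ r),
      transmutation_congr hx (eqOn_iccExtend_expMap hℓ r), h r]
  exact DFunLike.congr_fun this u

/-- Continuity in x passes from exponentials to their span by linearity, then to uniform limits,
since the functionals have norm at most 1 + C for every x. -/
lemma continuousOn_transmutation_of_exp (hℓ : 0 < ℓ) {K : ℝ → ℝ → ℂ} {C : ℝ}
    (hK : ∀ x ∈ Icc 0 ℓ, IntervalIntegrable (K x) volume (-x) x)
    (hC : ∀ x ∈ Icc 0 ℓ, ∫ t in (-x)..x, ‖K x t‖ ≤ C)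
    (h : ∀ r : ℝ, ContinuousOn (transmutation K fun t => Complex.exp (Complex.I * r * t)) (Icc 0 ℓ))
    (u : C(Icc (-ℓ) ℓ, ℂ)) :
    ContinuousOn (transmutation K (IccExtend (neg_le_self hℓ.le) u)) (Icc 0 ℓ) := by
  have hC0 : 0 ≤ C := by simpa using hC 0 ⟨le_rfl, hℓ.le⟩
  have hspan : ∀ w ∈ Submodule.span ℂ (range (expMap ℓ)),
      ContinuousOn (transmutation K (IccExtend (neg_le_self hℓ.le) w)) (Icc 0 ℓ) := by
    intro w hw
    induction hw using Submodule.span_induction with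
    | mem w hw =>
      obtain ⟨r, rfl⟩ := hw
      exact (h r).congr fun x hx => transmutation_congr hx (eqOn_iccExtend_expMap hℓ r)
    | zero =>
      refine (continuousOn_const (c := (0 : ℂ))).congr fun x hx => ?_
      exact map_zero (transmutationAt hℓ K hx.1 (hK x hx))
    | add v w _ _ hv hw =>
      exact (hv.add hw).congr fun x hx => map_add (transmutationAt hℓ K hx.1 (hK x hx)) v w
    | smul c w _ hw =>
      exact (hw.const_smul c).congr fun x hx =>
        map_smul (transmutationAt hℓ K hx.1 (hK x hx)) c w
  refine continuousOn_of_uniform_approx_of_continuousOn fun U hU => ?_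
  obtain ⟨ε, hε, hεU⟩ := Metric.mem_uniformity_dist.1 hU
  obtain ⟨w, hw, hd⟩ := Metric.mem_closure_iff.1 (dense_span_expMap u) (ε / (1 + C)) (by positivity)
  refine ⟨_, hspan w hw, fun x hx => hεU ?_⟩
  have h1 := map_sub (transmutationAt hℓ K hx.1 (hK x hx)) u w
  rw [transmutationAt_apply, transmutationAt_apply, transmutationAt_apply] at h1
  rw [dist_eq_norm, ← h1]
  rw [dist_eq_norm, lt_div_iff₀ (by positivity), mul_comm] at hd
  refine (norm_transmutation_le hℓ hx.1 (hK x hx) _).trans_lt (lt_of_le_of_lt ?_ hd)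
  gcongr
  exact hC x hx

/-- A family of functionals `transmutationAt` that is uniformly bounded and continuous in `x`
is a bounded operator from `C[-ℓ, ℓ]` to `C[0, ℓ]`. -/
lemma exists_transmutationCLM (hℓ : 0 < ℓ) {K : ℝ → ℝ → ℂ} {C : ℝ}
    (hK : ∀ x ∈ Icc 0 ℓ, IntervalIntegrable (K x) volume (-x) x)
    (hC : ∀ x ∈ Icc 0 ℓ, ∫ t in (-x)..x, ‖K x t‖ ≤ C)
    (hc : ∀ u : C(Icc (-ℓ) ℓ, ℂ),
      ContinuousOn (transmutation K (IccExtend (neg_le_self hℓ.le) u)) (Icc 0 ℓ)) :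
    ∃ T : C(Icc (-ℓ) ℓ, ℂ) →L[ℂ] C(Icc (0 : ℝ) ℓ, ℂ),
      ∀ (u : C(Icc (-ℓ) ℓ, ℂ)) (x : Icc (0 : ℝ) ℓ),
        T u x = transmutation K (IccExtend (neg_le_self hℓ.le) u) x := by
  have hC0 : 0 ≤ C := by simpa using hC 0 ⟨le_rfl, hℓ.le⟩
  refine ⟨LinearMap.mkContinuous
    { toFun := fun u => ⟨fun x => transmutation K (IccExtend (neg_le_self hℓ.le) u) x,
        (hc u).domRestrict⟩
      map_add' := fun u w => ContinuousMap.ext fun x =>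
        map_add (transmutationAt hℓ K x.2.1 (hK x x.2)) u w
      map_smul' := fun c w => ContinuousMap.ext fun x =>
        map_smul (transmutationAt hℓ K x.2.1 (hK x x.2)) c w } (1 + C) fun u => ?_, fun _ _ => rfl⟩
  rw [ContinuousMap.norm_le _ (by positivity)]
  intro x
  refine (norm_transmutation_le hℓ x.2.1 (hK x x.2) u).trans ?_
  gcongr
  exact hC x x.2

end Operator


end DistSchrodinger

/-! ### Transfer from `expKernel` to an arbitrary kernel. -/

theorem mainTheorem12 (ℓ : ℝ) (hℓ : 0 < ℓ) (σ f : ℝ → ℂ)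
    (hσ : MeasureTheory.MemLp σ 2 (MeasureTheory.volume.restrict (Set.Ioo 0 ℓ)))
    (hf : DistSchrodinger.IsNonvanishingSolution ℓ σ f) :
    (∃ K : ℝ → ℝ → ℂ, DistSchrodinger.IsTransmutationKernel ℓ σ f K) ∧
    ∀ K : ℝ → ℝ → ℂ, DistSchrodinger.IsTransmutationKernel ℓ σ f K →
      (∀ u : ℝ → ℂ, ContinuousOn u (Set.Icc (-ℓ) ℓ) →
        ContinuousOn (DistSchrodinger.transmutation K u) (Set.Icc 0 ℓ)) ∧
      ∃ T : C(Set.Icc (-ℓ) ℓ, ℂ) →L[ℂ] C(Set.Icc (0 : ℝ) ℓ, ℂ),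
        ∀ (u : C(Set.Icc (-ℓ) ℓ, ℂ)) (x : Set.Icc (0 : ℝ) ℓ),
          T u x = DistSchrodinger.transmutation K
            (Set.IccExtend (neg_le_self hℓ.le) u) x := by
  open DistSchrodinger in
  obtain ⟨f', hf', -⟩ := hf.solves
  obtain ⟨h, hh, hhf⟩ := exists_coefficient (memLp_logDeriv hℓ hf' hf.ne_zero)
  have hE := isTransmutationKernel_expKernel hℓ hf hf' hh hhf
  refine ⟨⟨_, hE⟩, fun K hK => ?_⟩
  obtain ⟨C, hC0, hC⟩ := exists_integral_norm_expKernel_le hℓ hh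
  have hEi : ∀ x ∈ Icc 0 ℓ, IntervalIntegrable (expKernel h x) volume (-x) x := fun x hx =>
    (hC x hx.2).1.intervalIntegrable
  have hEC : ∀ x ∈ Icc 0 ℓ, ∫ t in (-x)..x, ‖expKernel h x t‖ ≤ C := fun x hx => by
    rw [intervalIntegral.integral_of_le (by linarith [hx.1])]
    exact (setIntegral_le_integral (hC x hx.2).1.norm
      (Filter.Eventually.of_forall fun t => norm_nonneg _)).trans (hC x hx.2).2
  have hEc := continuousOn_transmutation_of_exp hℓ hEi hEC fun r =>
    ((hasL2Deriv_expSolution hℓ hh r).continuousOn hℓ).congr fun x hx =>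
      (expSolution_eq_transmutation hℓ hh r hx).symm
  -- An arbitrary `K` comes with no L¹ bound uniform in x; its operator inherits everything by
  -- coinciding with that of `expKernel`.
  have heq : ∀ u : C(Icc (-ℓ) ℓ, ℂ), ∀ x ∈ Icc 0 ℓ,
      transmutation K (IccExtend (neg_le_self hℓ.le) u) x =
        transmutation (expKernel h) (IccExtend (neg_le_self hℓ.le) u) x := by
    intro u x hx
    -- At x = 0, where nothing is assumed of `K`, the integral is over a degenerate interval and
    -- both sides are u(0).
    rcases hx.1.eq_or_lt with rfl | hx0
    · simp [transmutation]
    have hx' : x ∈ Ioc 0 ℓ := ⟨hx0, hx.2⟩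
    refine transmutation_eq_of_exp hℓ hx ?_ (hEi x hx) (fun r => ?_) u
    · rw [intervalIntegrable_iff_integrableOn_Ioo_of_le (by linarith)]
      exact (hK.memLp_slice x hx').integrable (by norm_num)
    · obtain ⟨e, he, hrepr⟩ := hK.repr r
      rw [← hrepr x hx', ← expSolution_eq_transmutation hℓ hh r hx]
      exact he.eqOn hℓ hf (isExpSolution_expSolution hℓ hf hf' hh hhf r) hx
  constructor
  · intro u hu
    let w : C(Icc (-ℓ) ℓ, ℂ) := ⟨(Icc (-ℓ) ℓ).domRestrict u, hu.domRestrict⟩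
    have hw : EqOn u (IccExtend (neg_le_self hℓ.le) w) (Icc (-ℓ) ℓ) := fun t ht => by
      rw [IccExtend_of_mem _ _ ht]
      rfl
    exact (hEc w).congr fun x hx => (transmutation_congr hx hw).trans (heq w x hx)
  · obtain ⟨T, hT⟩ := exists_transmutationCLM hℓ hEi hEC hEc
    exact ⟨T, fun u x => (hT u x).trans (heq u x x.2).symm⟩
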